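/- **Model.** Fix integers $C\ge 1$, $W\ge 0$, rates $\lambda_v,\lambda_d,\mu_v,\mu_d>0$, reals $R_{L,V},R_{L,D}$ and a function $R_{W,D}:\mathbb N\to\mathbb R$. A state is a triple $s=(i,j,k)$ ($i$ voice users in LTE, $j$ data users in LTE, $k$ data users in WiFi); $\mathcal S=\{(i,j,k): i+j\le C,\ k\le W\}$. In state $(i,j,k)$ the events are: voice arrival (rate $\lambda_v$), data arrival ($\lambda_d$), departure of a voice user from LTE ($i\mu_v$), of a data user from LTE ($j\mu_d$), of a data user from WiFi ($k\mu_d$); $v(s)$ is the sum of these rates. At each event a feasible action is chosen, and the state moves as follows. * Voice arrival: $A_1$ (block; feasible if $s\ne(0,0,0)$) leaves $s$ unchanged; $A_2$ (feasible if $i+j<C$) leads to $(i+1,j,k)$; $A_4$ (feasible if $j>0$, $k<W$) leads to $(i+1,j-1,k+1)$. * Data arrival: $A_1$ (block; feasible only if $i+j=C$, $k=W$) leaves $s$ unchanged; $A_2$ (accept in LTE; feasible if $i+j<C$) leads to $(i,j+1,k)$; $A_3$ (accept in WiFi; feasible if $k<W$) leads to $(i,j,k+1)$. * Departures: $A_1$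 (do nothing) just removes the user; $A_5$ also moves one data user to the network the departure came from. After a departure from LTE, $A_5$ moves a user from WiFi to LTE and needs $k>0$; after a departure from WiFi, it moves a user from LTE to WiFi and needs $j>0$. Let $f(i,j,k)=iR_{L,V}+jR_{L,D}+kR_{W,D}(k)$. Between events the reward rate is $f$ of the current state, and the cost rate is $1$ if the last event was a voice arrival that was blocked and $0$ otherwise. For $\beta\in\mathbb R$ the net reward rate is reward rate minus $\beta$ times cost rate ($\beta=0$ is the unconstrained problem). A memoryless policy chooses, for each state and event, a feasible action, possibly at random; it is pure if it never randomizes. It is *optimal* for $\beta$ if from every initial state its long-run average expected net reward in continuous time exists and is at least that of every memoryless policy. A state *occurs* under a policy if it is visited with positive probability when the system starts empty (these are the recurrent states). **Assumption 1.** With $\tilde R_{W,D}(k)=(k+1)R_{W,D}(k+1)-kR_{W,D}(k)$, the integer $0\le k_{th}\le W$ satisfies $R_{L,D}\ge\tilde R_{W,D}(k)$ for $k_{th}\le k<W$ and $R_{L,D}<\tilde R_{W,D}(k)$ for $k<k_{th}$. **Threshold structure.** A policy has the threshold structure if in every state $(i,j,k)$ with $i+j<C$ that occurs under it: * if $j+k>k_{th}$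 then $k=k_{th}$: exactly $k_{th}$ data users are served by WiFi and all others by LTE (also if $j+k=k_{th}$); * (a) if $j+k\ge k_{th}$, an arriving data user is accepted in LTE ($A_2$); * (b) if $j+k>k_{th}$, nothing is done ($A_1$) upon a departure of a voice or data user from LTE; * (c) if $j+k>k_{th}$, a data user is moved from LTE to WiFi ($A_5$) upon a departure of a data user from WiFi. **Threshold rule.** In a state with $j+k\ge k_{th}$, upon a data arrival: $A_2$ if $k\ge k_{th}$, else $A_3$. In a state with $j+k>k_{th}$, upon a departure from LTE: $A_1$ if $k\le k_{th}$, else $A_5$; upon a departure from WiFi: $A_5$ if $k\le k_{th}$, else $A_1$. (For $k=k_{th}$ these are the actions in (a), (b), (c).) **Lemma 2.** Let Assumption 1 hold and let $\beta\in\mathbb R$. 1. There is a pure optimal policy that has the threshold structure and follows the threshold rule in every state of $\mathcal S$ with $i+j<C$. 2. If moreover $R_{L,D}>\tilde R_{W,D}(k)$ for all $k_{th}\le k<W$ (no ties), every optimal memoryless policy has the threshold structure. 3. Let $\delta>0$ with $\delta v(s)\le1$ on $\mathcal S$, let $p(s,E)=\delta\cdot(\text{rate of }E\text{ in }s)$,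 and let $V_0=0$ and $$V_{n+1}(s)=\sum_E p(s,E)\max_a\big[f(s')-\beta c+V_n(s')\big]+\Big(1-\sum_E p(s,E)\Big)V_n(s),$$ where $a$ runs over the feasible actions, $s'$ is the state after $E$ and $a$, and $c=1$ if $(E,a)$ blocks a voice user, $c=0$ otherwise. Then for every $n$, every $s\in\mathcal S$ with $i+j<C$ and every event possible in $s$ for which the threshold rule prescribes an action, that action attains the maximum in the bracket. -/

import Mathlib

/-- A state `(i, j, k)`: `i` voice users in LTE, `j` data users in LTE, `k` data users in WiFi. -/
structure NetState where
  i : ℕ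
  j : ℕ
  k : ℕ
  deriving DecidableEq

/-- The five events. -/
inductive NetEvent
  | voiceArrival
  | dataArrival
  | voiceDepartureLTE
  | dataDepartureLTE
  | dataDepartureWiFi
  deriving DecidableEq

instance : Fintype NetEvent where
  elems := {.voiceArrival, .dataArrival, .voiceDepartureLTE, .dataDepartureLTE, .dataDepartureWiFi}
  complete := by intro x; cases x <;> simp

/-- The five actions: `A1` block / do nothing, `A2` accept in LTE, `A3` accept a data user in WiFi,
`A4` accept a voice user in LTE and offload one data user to WiFi, `A5` move one data user to the
RAT from which the departure occurred. -/
inductive NetAction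
  | A1
  | A2
  | A3
  | A4
  | A5
  deriving DecidableEq

instance : Fintype NetAction where
  elems := {.A1, .A2, .A3, .A4, .A5}
  complete := by intro x; cases x <;> simp

/-- Parameters of the LTE-WiFi system. `RWD k` is the per-user WiFi throughput with `k` users. -/
structure NetModel where
  C : ℕ
  W : ℕ
  lamV : ℝ
  lamD : ℝ
  muV : ℝ
  muD : ℝ
  RLV : ℝ
  RLD : ℝ
  RWD : ℕ → ℝ
  C_pos : 0 < C
  lamV_pos : 0 < lamV
  lamD_pos : 0 < lamD
  muV_pos : 0 < muV
  muD_pos : 0 < muD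

namespace NetModel

variable (m : NetModel)

/-- The finite state space: `i + j ≤ C` and `k ≤ W`. -/
def states : Finset NetState :=
  ((Finset.range (m.C + 1) ×ˢ Finset.range (m.C + 1) ×ˢ Finset.range (m.W + 1)).filter
    (fun p => p.1 + p.2.1 ≤ m.C)).image (fun p => ⟨p.1, p.2.1, p.2.2⟩)

theorem mem_states (s : NetState) : s ∈ m.states ↔ s.i + s.j ≤ m.C ∧ s.k ≤ m.W := by
  obtain ⟨i, j, k⟩ := s
  simp only [states, Finset.mem_image, Finset.mem_filter, Finset.mem_product, Finset.mem_range,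
    NetState.mk.injEq, Prod.exists]
  constructor
  · rintro ⟨a, b, c, ⟨h1, h2⟩, rfl, rfl, rfl⟩
    omega
  · intro h
    exact ⟨i, j, k, by omega, rfl, rfl, rfl⟩

/-- Rate of each event in a state. -/
def rate (s : NetState) : NetEvent → ℝ
  | .voiceArrival => m.lamV
  | .dataArrival => m.lamD
  | .voiceDepartureLTE => s.i * m.muV
  | .dataDepartureLTE => s.j * m.muD
  | .dataDepartureWiFi => s.k * m.muD

/-- The total event rate `v(i, j, k)`. -/
def totalRate (s : NetState) : ℝ := ∑ E, m.rate s E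

/-- `Feasible s E a`: action `a` is feasible in state `s` under event `E`. -/
def Feasible (s : NetState) (E : NetEvent) (a : NetAction) : Prop :=
  s ∈ m.states ∧
  match E, a with
  | .voiceArrival, .A1 => s ≠ ⟨0, 0, 0⟩
  | .voiceArrival, .A2 => s.i + s.j ≠ m.C
  | .voiceArrival, .A4 => ¬ (s.j = 0 ∨ s.k = m.W)
  | .dataArrival, .A1 => s.i + s.j = m.C ∧ s.k = m.W
  | .dataArrival, .A2 => s.i + s.j ≠ m.C
  | .dataArrival, .A3 => s.k ≠ m.W
  | .voiceDepartureLTE, .A1 => s.i ≠ 0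
  | .voiceDepartureLTE, .A5 => ¬ (s.i = 0 ∨ s.k = 0)
  | .dataDepartureLTE, .A1 => s.j ≠ 0
  | .dataDepartureLTE, .A5 => ¬ (s.j = 0 ∨ s.k = 0)
  | .dataDepartureWiFi, .A1 => s.k ≠ 0
  | .dataDepartureWiFi, .A5 => ¬ (s.j = 0 ∨ s.k = 0)
  | _, _ => False

end NetModel

/-- The state after event `E` and action `a`. Only feasible combinations matter; the others are
given the value `s`. -/
def NetState.next (s : NetState) : NetEvent → NetAction → NetState
  | .voiceArrival, .A2 => ⟨s.i + 1, s.j, s.k⟩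
  | .voiceArrival, .A4 => ⟨s.i + 1, s.j - 1, s.k + 1⟩
  | .dataArrival, .A2 => ⟨s.i, s.j + 1, s.k⟩
  | .dataArrival, .A3 => ⟨s.i, s.j, s.k + 1⟩
  | .voiceDepartureLTE, .A1 => ⟨s.i - 1, s.j, s.k⟩
  | .voiceDepartureLTE, .A5 => ⟨s.i - 1, s.j + 1, s.k - 1⟩
  | .dataDepartureLTE, .A1 => ⟨s.i, s.j - 1, s.k⟩
  | .dataDepartureLTE, .A5 => ⟨s.i, s.j, s.k - 1⟩
  | .dataDepartureWiFi, .A1 => ⟨s.i, s.j, s.k - 1⟩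
  | .dataDepartureWiFi, .A5 => ⟨s.i, s.j - 1, s.k⟩
  | _, _ => s

/-- Whether the event-action pair blocks a voice user. -/
def blocksVoice : NetEvent → NetAction → Bool
  | .voiceArrival, .A1 => true
  | _, _ => false

namespace NetModel

variable (m : NetModel)

/-- Total system throughput `f(i, j, k)`. -/
def throughput (s : NetState) : ℝ := s.i * m.RLV + s.j * m.RLD + s.k * m.RWD s.k

/-- Reward per unit time with multiplier `β`, given the state `s` that follows the last event and
the flag `b` that says whether the last event was a blocked voice arrival:
throughput minus `β` times the blocking cost. -/
def netReward (β : ℝ) (s : NetState) (b : Bool) : ℝ :=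
  m.throughput s - β * (if b then 1 else 0)

/-- Increment of the total WiFi throughput from `k` to `k + 1` users. -/
def wifiIncrement (k : ℕ) : ℝ := ((k : ℝ) + 1) * m.RWD (k + 1) - k * m.RWD k

/-- The threshold assumption, for the WiFi loads `k` with `k + 1 ≤ W`. -/
def IsThreshold (kth : ℕ) : Prop :=
  kth ≤ m.W ∧
  (∀ k, kth ≤ k → k < m.W → m.wifiIncrement k ≤ m.RLD) ∧
  (∀ k, k < kth → m.RLD < m.wifiIncrement k)

/-! ### Memoryless policies and long-run average reward in continuous time -/

/-- A memoryless, possibly randomized, policy: `prob s E a` is the probability of choosing `a` when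
`E` occurs in `s`. -/
structure Policy where
  prob : NetState → NetEvent → NetAction → ℝ
  nonneg : ∀ s E a, 0 ≤ prob s E a
  feasible : ∀ s E a, prob s E a ≠ 0 → m.Feasible s E a
  sum_one : ∀ s ∈ m.states, ∀ E, 0 < m.rate s E → ∑ a, prob s E a = 1

/-- A pure policy always chooses one action with certainty. -/
def Policy.IsPure {m : NetModel} (M : m.Policy) : Prop :=
  ∀ s E a, M.prob s E a = 0 ∨ M.prob s E a = 1

/-- A configuration: current state, and whether the last event was a blocked voice arrival
(this determines the current reward and cost rates). -/
abbrev Config : Type := {s : NetState // s ∈ m.states} × Bool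

variable {m}

/-- Generator of the continuous-time Markov chain induced by a policy. -/
def Policy.generator (M : m.Policy) : Matrix m.Config m.Config ℝ := fun x y =>
  (∑ E, ∑ a, m.rate x.1.1 E * M.prob x.1.1 E a *
      (if x.1.1.next E a = y.1.1 ∧ blocksVoice E a = y.2 then 1 else 0))
    - (if x = y then m.totalRate x.1.1 else 0)

/-- Transition matrix `exp (tQ)` of the chain at time `t`. -/
noncomputable def Policy.transition (M : m.Policy) (t : ℝ) : Matrix m.Config m.Config ℝ :=
  NormedSpace.exp (t • M.generator)

/-- Expected total (net) reward up to time `t` from the initial state `s`. -/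
noncomputable def Policy.expectedReward (M : m.Policy) (β : ℝ)
    (s : {s : NetState // s ∈ m.states}) (t : ℝ) : ℝ :=
  ∫ u in (0 : ℝ)..t, ∑ y : m.Config, M.transition u (s, false) y * m.netReward β y.1.1 y.2

/-- `M` maximizes the long-run average net reward over all memoryless policies, from every initial
state: its averages converge, and no policy has a larger limit superior. -/
def Policy.IsOptimal (M : m.Policy) (β : ℝ) : Prop :=
  ∀ s : {s : NetState // s ∈ m.states}, ∃ v : ℝ,
    Filter.Tendsto (fun t : ℝ => M.expectedReward β s t / t) Filter.atTop (nhds v) ∧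
    ∀ (M' : m.Policy) (ε : ℝ), 0 < ε →
      ∀ᶠ t : ℝ in Filter.atTop, M'.expectedReward β s t / t ≤ v + ε

/-- States that the system, started empty, visits with positive probability under `M`. The empty
state can be reached from every state under every policy, so these are exactly the recurrent
states under `M`. -/
inductive Policy.Reachable (M : m.Policy) : NetState → Prop
  | empty : Policy.Reachable M ⟨0, 0, 0⟩
  | step (s : NetState) (E : NetEvent) (a : NetAction) :
      Policy.Reachable M s → 0 < m.rate s E → 0 < M.prob s E a → Policy.Reachable M (s.next E a)

/-! ### Uniformized discrete-time dynamic programming -/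

variable (m)

/-- The bracket `r̂(s, E, a; β) + V(s')` of the dynamic programming equation. -/
def qValue (β : ℝ) (V : NetState → ℝ) (s : NetState) (E : NetEvent) (a : NetAction) : ℝ :=
  m.netReward β (s.next E a) (blocksVoice E a) + V (s.next E a)

/-- Value iteration with uniformization step `δ`, started from `0`. -/
noncomputable def valueIter (β δ : ℝ) : ℕ → NetState → ℝ
  | 0 => fun _ => 0
  | n + 1 => fun s =>
      (∑ E, δ * m.rate s E *
        ⨆ a : {a : NetAction // m.Feasible s E a}, m.qValue β (valueIter β δ n) s E a.1)
      + (1 - ∑ E, δ * m.rate s E) * valueIter β δ n s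

/-- `a` is an optimal action in state `s` under event `E` for the continuation value `V`. -/
def IsOptimalAction (β : ℝ) (V : NetState → ℝ) (s : NetState) (E : NetEvent) (a : NetAction) : Prop :=
  m.Feasible s E a ∧ ∀ a', m.Feasible s E a' → m.qValue β V s E a' ≤ m.qValue β V s E a

end NetModel

/-- The threshold rule for data users, in states where the number `j + k` of data users exceeds
`kth` (or equals `kth`, upon a data arrival). If `k = kth` it prescribes: accept an arriving data
user in LTE, do nothing upon a departure from LTE, and move a data user from LTE to WiFi upon a
departure from WiFi. In states with `k ≠ kth` it prescribes the action that brings the number of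
WiFi users towards `kth`. -/
inductive ThresholdRule (kth : ℕ) (s : NetState) : NetEvent → NetAction → Prop
  | acceptLTE : kth ≤ s.j + s.k → kth ≤ s.k → ThresholdRule kth s .dataArrival .A2
  | acceptWiFi : kth ≤ s.j + s.k → s.k < kth → ThresholdRule kth s .dataArrival .A3
  | voiceLTE : kth < s.j + s.k → s.k ≤ kth → ThresholdRule kth s .voiceDepartureLTE .A1
  | voiceLTE' : kth < s.j + s.k → kth < s.k → ThresholdRule kth s .voiceDepartureLTE .A5
  | dataLTE : kth < s.j + s.k → s.k ≤ kth → ThresholdRule kth s .dataDepartureLTE .A1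
  | dataLTE' : kth < s.j + s.k → kth < s.k → ThresholdRule kth s .dataDepartureLTE .A5
  | dataWiFi : kth < s.j + s.k → s.k ≤ kth → ThresholdRule kth s .dataDepartureWiFi .A5
  | dataWiFi' : kth < s.j + s.k → kth < s.k → ThresholdRule kth s .dataDepartureWiFi .A1

/-- In every state that occurs under `M` and has `i + j < C`: if there are at least `kth` data users
then exactly `kth` of them are served by WiFi; an arriving data user is then accepted in LTE; and if
there are more than `kth` data users, nothing is done upon a departure from LTE and a data user is
moved from LTE to WiFi upon a departure from WiFi. -/
def NetModel.Policy.ServesThreshold {m : NetModel} (M : m.Policy) (kth : ℕ) : Prop :=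
  ∀ s, M.Reachable s → s.i + s.j < m.C →
    (kth ≤ s.j + s.k → s.k = kth ∧ M.prob s .dataArrival .A2 = 1) ∧
    (kth < s.j + s.k →
      (0 < s.i → M.prob s .voiceDepartureLTE .A1 = 1) ∧
      (0 < s.j → M.prob s .dataDepartureLTE .A1 = 1) ∧
      (0 < s.k → M.prob s .dataDepartureWiFi .A5 = 1))

/-! ### Rates, feasibility and transitions -/

namespace NetModel

variable (m : NetModel)

/-! Everything rests on one shape property, `WifiUnimodal`: with the numbers of voice and data users
fixed, a function of the state rises with the WiFi load up to `kth` and falls from there on. The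
throughput has it by the choice of `kth`, and the Bellman sum preserves it
(`WifiUnimodal.bellmanSum`) by a coupling. Two states that differ by moving one data user between
the networks have the same arrival and voice departure rates and the same total data departure rate,
and whatever is done in the worse state can be matched or beaten in the better one. For a unimodal
continuation value, an action that brings the WiFi load closest to `kth` is best; by induction this
settles value iteration.

For long-run averages, a gain `g` and a unimodal relative value `h` solving the optimality equation
are found by vanishing discount (`exists_averageOptimality`). The discounted equation is the fixed
point of a contraction that preserves unimodality, a Lyapunov function bounds the relative values
uniformly in the discount rate, and a subsequence converges.

Dynkin's formula then says that the average reward of any policy is `g` minus its average `defect`,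
the nonnegative loss against the best actions. Hence no policy beats `g` and greedy policies attain
it. An optimal policy has zero defect in every state that occurs, because such a state keeps a
transition probability bounded away from zero.

The threshold structure comes from the set of `Aligned` states, which contains the empty state. An
action leaving this set has a feasible alternative ending closer to `kth`, at least as good by
unimodality and strictly better without ties (`lt_of_toward`). So the best actions closest to `kth`
give a policy with the structure, and without ties every optimal policy stays aligned. -/

theorem rate_nonneg (s : NetState) (E : NetEvent) : 0 ≤ m.rate s E := by
  have := m.lamV_pos; have := m.lamD_pos; have := m.muV_pos; have := m.muD_pos
  cases E <;> simp only [rate] <;> positivity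

theorem sum_event (F : NetEvent → ℝ) :
    ∑ E, F E = F .voiceArrival + F .dataArrival + F .voiceDepartureLTE + F .dataDepartureLTE
      + F .dataDepartureWiFi := by
  change ∑ E ∈ ({.voiceArrival, .dataArrival, .voiceDepartureLTE, .dataDepartureLTE,
    .dataDepartureWiFi} : Finset NetEvent), F E = _
  simp only [Finset.sum_insert, Finset.mem_insert, Finset.mem_singleton, reduceCtorEq, or_self,
    not_false_eq_true, Finset.sum_singleton]
  ring

theorem totalRate_eq (s : NetState) :
    m.totalRate s = m.lamV + m.lamD + s.i * m.muV + (s.j + s.k) * m.muD := by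
  simp only [totalRate, sum_event, rate]; ring

theorem totalRate_pos (s : NetState) : 0 < m.totalRate s := by
  have := m.lamV_pos; have := m.lamD_pos; have := m.muV_pos; have := m.muD_pos
  rw [totalRate_eq]; positivity

/-- Data users leave at the same rate `muD` in both networks. Uniformization weights and the
expected blocking cost `β / v` are therefore unaffected by moving a data user. -/
theorem totalRate_shift (i j k : ℕ) :
    m.totalRate ⟨i, j + 1, k⟩ = m.totalRate ⟨i, j, k + 1⟩ := by
  simp only [totalRate_eq]; push_cast; ring

theorem rate_departure_pos {s : NetState} :
    (0 < m.rate s .voiceDepartureLTE ↔ 0 < s.i) ∧ (0 < m.rate s .dataDepartureLTE ↔ 0 < s.j) ∧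
      (0 < m.rate s .dataDepartureWiFi ↔ 0 < s.k) := by
  simp [rate, m.muV_pos, m.muD_pos]

/-- Some action is feasible whenever the event can occur. -/
theorem exists_feasible {s : NetState} (hs : s ∈ m.states) {E : NetEvent} (hE : 0 < m.rate s E) :
    ∃ a, m.Feasible s E a := by
  have hC := m.C_pos
  obtain ⟨h1, h2, h3⟩ := m.rate_departure_pos (s := s)
  obtain ⟨i, j, k⟩ := s
  have hs' := (m.mem_states _).1 hs
  simp only at hs' h1 h2 h3
  cases E
  · by_cases h : i + j = m.C
    · refine ⟨.A1, hs, ?_⟩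
      simp only [ne_eq, NetState.mk.injEq]; omega
    · exact ⟨.A2, hs, h⟩
  · by_cases h : i + j = m.C
    · by_cases hk : k = m.W
      · exact ⟨.A1, hs, h, hk⟩
      · exact ⟨.A3, hs, hk⟩
    · exact ⟨.A2, hs, h⟩
  · exact ⟨.A1, hs, (h1.1 hE).ne'⟩
  · exact ⟨.A1, hs, (h2.1 hE).ne'⟩
  · exact ⟨.A1, hs, (h3.1 hE).ne'⟩

theorem Feasible.next_mem {m : NetModel} {s : NetState} {E : NetEvent} {a : NetAction}
    (h : m.Feasible s E a) : s.next E a ∈ m.states := by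
  obtain ⟨i, j, k⟩ := s
  obtain ⟨hs, h⟩ := h
  have hs' := (m.mem_states _).1 hs
  rw [mem_states]
  cases E <;> cases a <;> simp_all [NetState.next] <;> omega

/-- This is why the blocking cost, incurred until the event after the blocking, can be charged with
the total rate of the state in which the blocking occurs. -/
theorem next_of_blocksVoice {s : NetState} {E : NetEvent} {a : NetAction}
    (h : blocksVoice E a = true) : s.next E a = s := by
  cases E <;> cases a <;> simp_all [blocksVoice, NetState.next]

/-! ### The Bellman operator -/

/-- Continuation value `J` of the successor state, minus `c` if a voice user is blocked. -/
def contValue (c : ℝ) (J : NetState → ℝ) (s : NetState) (E : NetEvent) (a : NetAction) : ℝ :=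
  J (s.next E a) - if blocksVoice E a then c else 0

/-- The largest continuation value over the feasible actions. -/
noncomputable def bestValue (c : ℝ) (J : NetState → ℝ) (s : NetState) (E : NetEvent) : ℝ :=
  ⨆ a : {a : NetAction // m.Feasible s E a}, contValue c J s E a.1

/-- The rate-weighted sum of the best continuation values over all events. -/
noncomputable def bellmanSum (c : ℝ) (J : NetState → ℝ) (s : NetState) : ℝ :=
  ∑ E, m.rate s E * m.bestValue c J s E

variable {m}

theorem contValue_le_bestValue {c : ℝ} {J : NetState → ℝ} {s : NetState} {E : NetEvent}
    {a : NetAction} (h : m.Feasible s E a) : contValue c J s E a ≤ m.bestValue c J s E :=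
  le_ciSup (f := fun a : {a : NetAction // m.Feasible s E a} => contValue c J s E a.1)
    (Set.finite_range _).bddAbove ⟨a, h⟩

theorem exists_bestValue {s : NetState} (hs : s ∈ m.states) {E : NetEvent} (hE : 0 < m.rate s E)
    (c : ℝ) (J : NetState → ℝ) :
    ∃ a, m.Feasible s E a ∧ m.bestValue c J s E = contValue c J s E a := by
  obtain ⟨a, ha⟩ := m.exists_feasible hs hE
  have : Nonempty {a : NetAction // m.Feasible s E a} := ⟨a, ha⟩
  obtain ⟨b, hb⟩ := exists_eq_ciSup_of_finite
    (f := fun a : {a : NetAction // m.Feasible s E a} => contValue c J s E a.1)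
  exact ⟨b.1, b.2, hb.symm⟩

/-- An event of rate zero may have no feasible action, so that `bestValue` is a supremum over an
empty type. The factor `rate` removes this meaningless value, which is why the comparisons are
stated for products. -/
theorem rate_mul_bestValue_le {c x : ℝ} {J : NetState → ℝ} {s : NetState} {E : NetEvent}
    (hs : s ∈ m.states) (h : ∀ a, m.Feasible s E a → contValue c J s E a ≤ x) :
    m.rate s E * m.bestValue c J s E ≤ m.rate s E * x := by
  rcases (m.rate_nonneg s E).eq_or_lt with h0 | h0
  · simp [← h0]
  · obtain ⟨a, ha, he⟩ := exists_bestValue hs h0 c J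
    exact mul_le_mul_of_nonneg_left (he ▸ h a ha) h0.le

theorem le_rate_mul_bestValue {c x : ℝ} {J : NetState → ℝ} {s : NetState} {E : NetEvent}
    (h : 0 < m.rate s E → ∃ a, m.Feasible s E a ∧ x ≤ contValue c J s E a) :
    m.rate s E * x ≤ m.rate s E * m.bestValue c J s E := by
  rcases (m.rate_nonneg s E).eq_or_lt with h0 | h0
  · simp [← h0]
  · obtain ⟨a, ha, he⟩ := h h0
    exact mul_le_mul_of_nonneg_left (he.trans (contValue_le_bestValue ha)) h0.le

theorem rate_mul_bestValue_mono {c : ℝ} {J : NetState → ℝ} {s s' : NetState} {E : NetEvent}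
    (hs : s ∈ m.states) (hr : m.rate s E = m.rate s' E)
    (h : ∀ a, m.Feasible s E a →
      ∃ a', m.Feasible s' E a' ∧ contValue c J s E a ≤ contValue c J s' E a') :
    m.rate s E * m.bestValue c J s E ≤ m.rate s' E * m.bestValue c J s' E := by
  rw [← hr]
  refine rate_mul_bestValue_le hs fun a ha => ?_
  obtain ⟨a', ha', hle⟩ := h a ha
  exact hle.trans (contValue_le_bestValue ha')

/-! ### Unimodality in the WiFi load and its preservation -/

variable (m)

/-- For a fixed number of voice users and of data users, `J` increases in the number of WiFi users
up to `kth` and decreases from there on. -/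
def WifiUnimodal (kth : ℕ) (J : NetState → ℝ) : Prop :=
  ∀ i j k, i + j < m.C → k < m.W →
    (k < kth → J ⟨i, j + 1, k⟩ ≤ J ⟨i, j, k + 1⟩) ∧
    (kth ≤ k → J ⟨i, j, k + 1⟩ ≤ J ⟨i, j + 1, k⟩)

variable {m}

theorem throughput_shift (i j k : ℕ) :
    m.throughput ⟨i, j, k + 1⟩ - m.throughput ⟨i, j + 1, k⟩ = m.wifiIncrement k - m.RLD := by
  simp only [throughput, wifiIncrement]; push_cast; ring

theorem throughput_unimodal {kth : ℕ} (h : m.IsThreshold kth) :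
    m.WifiUnimodal kth m.throughput := by
  intro i j k _ hk
  have := throughput_shift (m := m) i j k
  exact ⟨fun hlt => by linarith [h.2.2 k hlt], fun hle => by linarith [h.2.1 k hle hk]⟩

theorem WifiUnimodal.add {kth : ℕ} {J J' : NetState → ℝ} (h : m.WifiUnimodal kth J)
    (h' : m.WifiUnimodal kth J') : m.WifiUnimodal kth (fun s => J s + J' s) :=
  fun i j k hC hW => ⟨fun hk => add_le_add ((h i j k hC hW).1 hk) ((h' i j k hC hW).1 hk),
    fun hk => add_le_add ((h i j k hC hW).2 hk) ((h' i j k hC hW).2 hk)⟩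

section preservation

variable {kth : ℕ} {J : NetState → ℝ} {i j k : ℕ} {c : ℝ}

/-- Below the threshold the state with the larger WiFi load is the better one. For arrivals and
voice departures each action in the worse state is answered by one in the better state that leads to
the same successor or to the successor shifted towards `kth`. -/
theorem WifiUnimodal.bellmanSum_le (hJ : m.WifiUnimodal kth J) (hC : i + j < m.C) (hW : k < m.W)
    (hk : k < kth) : m.bellmanSum c J ⟨i, j + 1, k⟩ ≤ m.bellmanSum c J ⟨i, j, k + 1⟩ := by
  have hs : (⟨i, j + 1, k⟩ : NetState) ∈ m.states := by rw [mem_states]; simp only; omega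
  have hs' : (⟨i, j, k + 1⟩ : NetState) ∈ m.states := by rw [mem_states]; simp only; omega
  have hva := rate_mul_bestValue_mono (E := .voiceArrival) (c := c) (J := J) hs
    (s' := ⟨i, j, k + 1⟩) rfl (by
      rintro a ⟨-, ha⟩
      cases a <;> simp only [ne_eq, not_or] at ha
      · exact ⟨.A1, ⟨hs', by simp⟩, by simpa [contValue, NetState.next] using (hJ i j k hC hW).1 hk⟩
      · exact ⟨.A2, ⟨hs', by simp only; omega⟩, by
          simpa [contValue, NetState.next, blocksVoice] using (hJ (i + 1) j k (by omega) hW).1 hk⟩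
      · exact ⟨.A2, ⟨hs', by simp only; omega⟩, by
          simp [contValue, NetState.next, blocksVoice]⟩)
  have hda := rate_mul_bestValue_mono (E := .dataArrival) (c := c) (J := J) hs
    (s' := ⟨i, j, k + 1⟩) rfl (by
      rintro a ⟨-, ha⟩
      cases a <;> simp only [ne_eq] at ha
      · omega
      · exact ⟨.A2, ⟨hs', by simp only; omega⟩, by
          simpa [contValue, NetState.next, blocksVoice] using
            (hJ i (j + 1) k (by omega) hW).1 hk⟩
      · exact ⟨.A2, ⟨hs', by simp only; omega⟩, by
          simp [contValue, NetState.next, blocksVoice]⟩)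
  have hvd := rate_mul_bestValue_mono (E := .voiceDepartureLTE) (c := c) (J := J) hs
    (s' := ⟨i, j, k + 1⟩) rfl (by
      rintro a ⟨-, ha⟩
      cases a <;> simp only [ne_eq, not_or] at ha
      · exact ⟨.A5, ⟨hs', by simp only; omega⟩, by
          simp [contValue, NetState.next, blocksVoice]⟩
      · refine ⟨.A5, ⟨hs', by simp only; omega⟩, ?_⟩
        obtain ⟨k, rfl⟩ := Nat.exists_eq_succ_of_ne_zero ha.2
        simpa [contValue, NetState.next, blocksVoice] using
            (hJ (i - 1) (j + 1) k (by omega) (by omega)).1 (by omega))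
  -- The two data departure rates differ between the states and only their sum agrees. All four
  -- terms are therefore compared with the common value `J ⟨i, j, k⟩`, an upper bound in the worse
  -- state and attainable in the better one.
  have h1 := rate_mul_bestValue_le (E := .dataDepartureLTE) (c := c) (J := J)
    (x := J ⟨i, j, k⟩) hs (by
      rintro a ⟨-, ha⟩
      cases a <;> simp only [ne_eq, not_or] at ha
      · simp [contValue, NetState.next, blocksVoice]
      · obtain ⟨k, rfl⟩ := Nat.exists_eq_succ_of_ne_zero ha.2
        simpa [contValue, NetState.next, blocksVoice] using
            (hJ i j k (by omega) (by omega)).1 (by omega))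
  have h2 := rate_mul_bestValue_le (E := .dataDepartureWiFi) (c := c) (J := J)
    (x := J ⟨i, j, k⟩) hs (by
      rintro a ⟨-, ha⟩
      cases a <;> simp only [ne_eq, not_or] at ha
      · obtain ⟨k, rfl⟩ := Nat.exists_eq_succ_of_ne_zero ha
        simpa [contValue, NetState.next, blocksVoice] using
            (hJ i j k (by omega) (by omega)).1 (by omega)
      · simp [contValue, NetState.next, blocksVoice])
  have h3 := le_rate_mul_bestValue (E := .dataDepartureLTE) (c := c) (J := J)
    (x := J ⟨i, j, k⟩) (s := ⟨i, j, k + 1⟩) (fun h => ⟨.A5, ⟨hs', by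
      have := m.rate_departure_pos.2.1.1 h
      simp only at this ⊢; omega⟩, by simp [contValue, NetState.next, blocksVoice]⟩)
  have h4 := le_rate_mul_bestValue (E := .dataDepartureWiFi) (c := c) (J := J)
    (x := J ⟨i, j, k⟩) (s := ⟨i, j, k + 1⟩) (fun h => ⟨.A1, ⟨hs', by simp⟩, by
      simp [contValue, NetState.next, blocksVoice]⟩)
  simp only [bellmanSum, sum_event]
  have e : m.rate ⟨i, j + 1, k⟩ .dataDepartureLTE * J ⟨i, j, k⟩
      + m.rate ⟨i, j + 1, k⟩ .dataDepartureWiFi * J ⟨i, j, k⟩ =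
      m.rate ⟨i, j, k + 1⟩ .dataDepartureLTE * J ⟨i, j, k⟩
      + m.rate ⟨i, j, k + 1⟩ .dataDepartureWiFi * J ⟨i, j, k⟩ := by
    simp only [rate]; push_cast; ring
  linarith

/-- The mirror image: from the threshold on, the state with the larger LTE load is the better one,
and it can offload a user by `A4`, `A3` or `A5` to imitate the other. -/
theorem WifiUnimodal.bellmanSum_ge (hJ : m.WifiUnimodal kth J) (hC : i + j < m.C) (hW : k < m.W)
    (hk : kth ≤ k) : m.bellmanSum c J ⟨i, j, k + 1⟩ ≤ m.bellmanSum c J ⟨i, j + 1, k⟩ := by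
  have hs : (⟨i, j + 1, k⟩ : NetState) ∈ m.states := by rw [mem_states]; simp only; omega
  have hs' : (⟨i, j, k + 1⟩ : NetState) ∈ m.states := by rw [mem_states]; simp only; omega
  have hva := rate_mul_bestValue_mono (E := .voiceArrival) (c := c) (J := J) hs'
    (s' := ⟨i, j + 1, k⟩) rfl (by
      rintro a ⟨-, ha⟩
      cases a <;> simp only [ne_eq, not_or] at ha
      · exact ⟨.A1, ⟨hs, by simp⟩, by simpa [contValue, NetState.next] using (hJ i j k hC hW).2 hk⟩
      · exact ⟨.A4, ⟨hs, by simp only; omega⟩, by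
          simp [contValue, NetState.next, blocksVoice]⟩
      · refine ⟨.A4, ⟨hs, by simp only; omega⟩, ?_⟩
        obtain ⟨j, rfl⟩ := Nat.exists_eq_succ_of_ne_zero ha.1
        simpa [contValue, NetState.next, blocksVoice] using
          (hJ (i + 1) j (k + 1) (by omega) (by omega)).2 (by omega))
  have hda := rate_mul_bestValue_mono (E := .dataArrival) (c := c) (J := J) hs'
    (s' := ⟨i, j + 1, k⟩) rfl (by
      rintro a ⟨-, ha⟩
      cases a <;> simp only [ne_eq] at ha
      · omega
      · exact ⟨.A3, ⟨hs, by simp only; omega⟩, by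
          simp [contValue, NetState.next, blocksVoice]⟩
      · exact ⟨.A3, ⟨hs, by simp only; omega⟩, by
          simpa [contValue, NetState.next, blocksVoice] using
            (hJ i j (k + 1) (by omega) (by omega)).2 (by omega)⟩)
  have hvd := rate_mul_bestValue_mono (E := .voiceDepartureLTE) (c := c) (J := J) hs'
    (s' := ⟨i, j + 1, k⟩) rfl (by
      rintro a ⟨-, ha⟩
      cases a <;> simp only [ne_eq, not_or] at ha
      · exact ⟨.A1, ⟨hs, by simp only; omega⟩, by
          simpa [contValue, NetState.next, blocksVoice] using
            (hJ (i - 1) j k (by omega) (by omega)).2 (by omega)⟩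
      · exact ⟨.A1, ⟨hs, by simp only; omega⟩, by
          simp [contValue, NetState.next, blocksVoice]⟩)
  have h1 := rate_mul_bestValue_le (E := .dataDepartureLTE) (c := c) (J := J)
    (x := J ⟨i, j, k⟩) hs' (by
      rintro a ⟨-, ha⟩
      cases a <;> simp only [ne_eq, not_or] at ha
      · obtain ⟨j, rfl⟩ := Nat.exists_eq_succ_of_ne_zero ha
        simpa [contValue, NetState.next, blocksVoice] using
            (hJ i j k (by omega) (by omega)).2 (by omega)
      · simp [contValue, NetState.next, blocksVoice])
  have h2 := rate_mul_bestValue_le (E := .dataDepartureWiFi) (c := c) (J := J)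
    (x := J ⟨i, j, k⟩) hs' (by
      rintro a ⟨-, ha⟩
      cases a <;> simp only [ne_eq, not_or] at ha
      · simp [contValue, NetState.next, blocksVoice]
      · obtain ⟨j, rfl⟩ := Nat.exists_eq_succ_of_ne_zero ha.1
        simpa [contValue, NetState.next, blocksVoice] using
            (hJ i j k (by omega) (by omega)).2 (by omega))
  have h3 := le_rate_mul_bestValue (E := .dataDepartureLTE) (c := c) (J := J)
    (x := J ⟨i, j, k⟩) (s := ⟨i, j + 1, k⟩) (fun h => ⟨.A1, ⟨hs, by simp⟩, by
      simp [contValue, NetState.next, blocksVoice]⟩)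
  have h4 := le_rate_mul_bestValue (E := .dataDepartureWiFi) (c := c) (J := J)
    (x := J ⟨i, j, k⟩) (s := ⟨i, j + 1, k⟩) (fun h => ⟨.A5, ⟨hs, by
      have := m.rate_departure_pos.2.2.1 h
      simp only at this ⊢; omega⟩, by simp [contValue, NetState.next, blocksVoice]⟩)
  simp only [bellmanSum, sum_event]
  have e : m.rate ⟨i, j + 1, k⟩ .dataDepartureLTE * J ⟨i, j, k⟩
      + m.rate ⟨i, j + 1, k⟩ .dataDepartureWiFi * J ⟨i, j, k⟩ =
      m.rate ⟨i, j, k + 1⟩ .dataDepartureLTE * J ⟨i, j, k⟩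
      + m.rate ⟨i, j, k + 1⟩ .dataDepartureWiFi * J ⟨i, j, k⟩ := by
    simp only [rate]; push_cast; ring
  linarith

end preservation

/-- The Bellman sum preserves unimodality if the blocking cost depends only on the numbers of voice
and data users. -/
theorem WifiUnimodal.bellmanSum {kth : ℕ} {J : NetState → ℝ} (hJ : m.WifiUnimodal kth J)
    {c : NetState → ℝ} (hc : ∀ i j k, c ⟨i, j + 1, k⟩ = c ⟨i, j, k + 1⟩) :
    m.WifiUnimodal kth (fun s => m.bellmanSum (c s) J s) :=
  fun i j k hC hW => ⟨fun hk => by simpa only [hc] using hJ.bellmanSum_le hC hW hk,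
    fun hk => by simpa only [hc] using hJ.bellmanSum_ge hC hW hk⟩

theorem WifiUnimodal.mul {kth : ℕ} {J : NetState → ℝ} (hJ : m.WifiUnimodal kth J)
    {w : NetState → ℝ} (hw : ∀ i j k, w ⟨i, j + 1, k⟩ = w ⟨i, j, k + 1⟩)
    (hw0 : ∀ s ∈ m.states, 0 ≤ w s) : m.WifiUnimodal kth (fun s => w s * J s) := by
  intro i j k hC hW
  have h0 := hw0 ⟨i, j, k + 1⟩ (by rw [mem_states]; simp only; omega)
  exact ⟨fun hk => by simpa only [hw] using mul_le_mul_of_nonneg_left ((hJ i j k hC hW).1 hk) h0,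
    fun hk => by simpa only [hw] using mul_le_mul_of_nonneg_left ((hJ i j k hC hW).2 hk) h0⟩

/-! ### The threshold rule attains the maximum -/

/-- `s'` arises from `s` by moving one data user so that the number of WiFi users gets closer to
`kth`. -/
def TowardThreshold (kth : ℕ) (s s' : NetState) : Prop :=
  s.i = s'.i ∧ ((s.k < kth ∧ s.k + 1 = s'.k ∧ s'.j + 1 = s.j) ∨
    (kth < s.k ∧ s'.k + 1 = s.k ∧ s.j + 1 = s'.j))

theorem WifiUnimodal.le_of_toward {kth : ℕ} {J : NetState → ℝ} (hJ : m.WifiUnimodal kth J)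
    {s s' : NetState} (hs : s ∈ m.states) (hs' : s' ∈ m.states) (h : TowardThreshold kth s s') :
    J s ≤ J s' := by
  obtain ⟨i, j, k⟩ := s
  obtain ⟨i', j', k'⟩ := s'
  rw [mem_states] at hs hs'
  simp only [TowardThreshold] at hs hs' h
  obtain ⟨rfl, ⟨hk, rfl, rfl⟩ | ⟨hk, rfl, rfl⟩⟩ := h
  · exact (hJ i j' k (by omega) (by omega)).1 hk
  · exact (hJ i j k' (by omega) (by omega)).2 (by omega)

/-- The action of the threshold rule is feasible and brings the number of WiFi users closer to
`kth` than every other feasible action. -/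
theorem _root_.ThresholdRule.toward {kth : ℕ} (hkth : kth ≤ m.W) {s : NetState}
    (hs : s ∈ m.states) (hC : s.i + s.j < m.C) {E : NetEvent} {a : NetAction}
    (hE : 0 < m.rate s E) (h : ThresholdRule kth s E a) :
    m.Feasible s E a ∧ ∀ a', m.Feasible s E a' →
      a' = a ∨ TowardThreshold kth (s.next E a') (s.next E a) := by
  obtain ⟨h1, h2, h3⟩ := m.rate_departure_pos (s := s)
  obtain ⟨i, j, k⟩ := s
  have hs' := (m.mem_states _).1 hs
  simp only at hs' h1 h2 h3 hC
  cases h <;> rename_i hn hk <;> simp only at hn hk <;>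
    (try simp only [hE, true_iff] at h1 h2 h3) <;>
    refine ⟨⟨hs, by simp only; omega⟩, ?_⟩ <;> rintro a ⟨-, ha⟩ <;> cases a <;>
    simp only [ne_eq, not_or] at ha <;>
    first
    | exact Or.inl rfl
    | refine Or.inr ⟨rfl, ?_⟩; simp only [NetState.next, and_true]; omega

theorem _root_.ThresholdRule.blocksVoice_eq_false {kth : ℕ} {s : NetState} {E : NetEvent}
    {a : NetAction} (h : ThresholdRule kth s E a) (a' : NetAction) : blocksVoice E a' = false := by
  cases h <;> rfl

/-- For a unimodal continuation value the action of the threshold rule is a best one. -/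
theorem WifiUnimodal.contValue_le_of_rule {kth : ℕ} (hkth : kth ≤ m.W) {J : NetState → ℝ}
    (hJ : m.WifiUnimodal kth J) (c : ℝ) {s : NetState} (hs : s ∈ m.states)
    (hC : s.i + s.j < m.C) {E : NetEvent} {a : NetAction} (hE : 0 < m.rate s E)
    (h : ThresholdRule kth s E a) :
    m.Feasible s E a ∧ ∀ a', m.Feasible s E a' → contValue c J s E a' ≤ contValue c J s E a := by
  obtain ⟨hf, ht⟩ := h.toward hkth hs hC hE
  refine ⟨hf, fun a' ha' => ?_⟩
  rcases ht a' ha' with rfl | hto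
  · rfl
  · simpa [contValue, h.blocksVoice_eq_false] using hJ.le_of_toward ha'.next_mem hf.next_mem hto

/-- The reward of the successor is absorbed into the continuation value, so that value iteration and
the continuous-time equation share one Bellman operator; only the blocking cost differs (`β` here,
`β / v` there). -/
theorem qValue_eq (β : ℝ) (V : NetState → ℝ) (s : NetState) (E : NetEvent) (a : NetAction) :
    m.qValue β V s E a = contValue β (fun s => m.throughput s + V s) s E a := by
  simp only [qValue, netReward, contValue]
  split_ifs <;> ring

theorem valueIter_succ (β δ : ℝ) (n : ℕ) (s : NetState) :
    m.valueIter β δ (n + 1) s =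
      δ * m.bellmanSum β (fun s => m.throughput s + m.valueIter β δ n s) s
        + (1 - δ * m.totalRate s) * m.valueIter β δ n s := by
  simp only [valueIter, bellmanSum, bestValue, totalRate, qValue_eq, Finset.mul_sum, mul_assoc]

/-- The bound on `δ` makes the weight of staying in the state nonnegative, so each iterate is a
nonnegative combination of unimodal functions. -/
theorem valueIter_unimodal {kth : ℕ} (hkth : m.IsThreshold kth) (β : ℝ) {δ : ℝ} (hδ : 0 < δ)
    (hδv : ∀ s ∈ m.states, δ * m.totalRate s ≤ 1) (n : ℕ) :
    m.WifiUnimodal kth (m.valueIter β δ n) := by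
  induction n with
  | zero => intro i j k _ _; simp [valueIter]
  | succ n ih =>
    have h1 := ((throughput_unimodal hkth).add ih).bellmanSum (c := fun _ => β) (fun _ _ _ => rfl)
    have h2 := h1.mul (w := fun _ => δ) (fun _ _ _ => rfl) (fun _ _ => hδ.le)
    have h3 := ih.mul (w := fun s => 1 - δ * m.totalRate s)
      (fun i j k => by rw [totalRate_shift]) (fun s hs => by linarith [hδv s hs])
    have h4 := h2.add h3
    intro i j k hC hW
    simpa only [valueIter_succ] using h4 i j k hC hW

theorem isOptimalAction_of_rule {kth : ℕ} (hkth : m.IsThreshold kth) (β : ℝ) {δ : ℝ} (hδ : 0 < δ)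
    (hδv : ∀ s ∈ m.states, δ * m.totalRate s ≤ 1) (n : ℕ) {s : NetState} (hs : s ∈ m.states)
    (hC : s.i + s.j < m.C) {E : NetEvent} {a : NetAction} (hE : 0 < m.rate s E)
    (h : ThresholdRule kth s E a) : m.IsOptimalAction β (m.valueIter β δ n) s E a := by
  have hV := (throughput_unimodal hkth).add (valueIter_unimodal hkth β hδ hδv n)
  simpa only [IsOptimalAction, qValue_eq] using hV.contValue_le_of_rule hkth.1 β hs hC hE h

end NetModel

namespace NetModel

variable {m : NetModel}

/-! ### Selections of one feasible action per event -/

/-- `σ` chooses a feasible action for every event that can occur in `s`. -/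
def IsSelection (m : NetModel) (s : NetState) (σ : NetEvent → NetAction) : Prop :=
  ∀ E, 0 < m.rate s E → m.Feasible s E (σ E)

theorem rate_mul_le_rate_mul {s : NetState} {E : NetEvent} {x y : ℝ}
    (h : 0 < m.rate s E → x ≤ y) : m.rate s E * x ≤ m.rate s E * y := by
  rcases (m.rate_nonneg s E).eq_or_lt with h0 | h0
  · simp [← h0]
  · exact mul_le_mul_of_nonneg_left (h h0) h0.le

theorem sum_rate_mul_const (s : NetState) (x : ℝ) : ∑ E, m.rate s E * x = m.totalRate s * x := by
  rw [totalRate, Finset.sum_mul]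

theorem exists_selection {s : NetState} (hs : s ∈ m.states) (c : ℝ) (J : NetState → ℝ) :
    ∃ σ, m.IsSelection s σ ∧ m.bellmanSum c J s = ∑ E, m.rate s E * contValue c J s E (σ E) := by
  have h : ∀ E, ∃ a, 0 < m.rate s E →
      m.Feasible s E a ∧ m.bestValue c J s E = contValue c J s E a := by
    intro E
    by_cases hE : 0 < m.rate s E
    · obtain ⟨a, ha⟩ := exists_bestValue hs hE c J
      exact ⟨a, fun _ => ha⟩
    · exact ⟨.A1, fun h => absurd h hE⟩
  choose σ hσ using h
  refine ⟨σ, fun E hE => (hσ E hE).1, Finset.sum_congr rfl fun E _ => ?_⟩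
  rcases (m.rate_nonneg s E).eq_or_lt with h0 | h0
  · simp [← h0]
  · rw [(hσ E h0).2]

theorem IsSelection.sum_le_bellmanSum {s : NetState} {σ : NetEvent → NetAction}
    (hσ : m.IsSelection s σ) (c : ℝ) (J : NetState → ℝ) :
    ∑ E, m.rate s E * contValue c J s E (σ E) ≤ m.bellmanSum c J s :=
  Finset.sum_le_sum fun E _ => rate_mul_le_rate_mul fun hE => contValue_le_bestValue (hσ E hE)

/-- The actions that are best for `J` remain feasible for `J'` and lose at most `x` per event. -/
theorem bellmanSum_le_add {s : NetState} (hs : s ∈ m.states) {J J' : NetState → ℝ} {x : ℝ}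
    (h : ∀ s' ∈ m.states, J s' ≤ J' s' + x) (c : ℝ) :
    m.bellmanSum c J s ≤ m.bellmanSum c J' s + m.totalRate s * x := by
  obtain ⟨σ, hσ, he⟩ := exists_selection hs c J
  have h1 := hσ.sum_le_bellmanSum c J'
  rw [he, ← sum_rate_mul_const]
  refine le_trans ?_ (add_le_add_left h1 _)
  rw [← Finset.sum_add_distrib]
  refine Finset.sum_le_sum fun E _ => ?_
  rw [← mul_add]
  refine rate_mul_le_rate_mul fun hE => ?_
  have := h _ (hσ E hE).next_mem
  simp only [contValue]; linarith

theorem abs_bellmanSum_sub_le {s : NetState} (hs : s ∈ m.states) {J J' : NetState → ℝ} {x : ℝ}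
    (h : ∀ s' ∈ m.states, |J s' - J' s'| ≤ x) (c : ℝ) :
    |m.bellmanSum c J s - m.bellmanSum c J' s| ≤ m.totalRate s * x := by
  have h1 := bellmanSum_le_add hs (J := J) (J' := J') (x := x)
    (fun s' hs' => by linarith [(abs_le.1 (h s' hs')).2]) c
  have h2 := bellmanSum_le_add hs (J := J') (J' := J) (x := x)
    (fun s' hs' => by linarith [(abs_le.1 (h s' hs')).1]) c
  rw [abs_le]; constructor <;> linarith

theorem bellmanSum_sub_const {s : NetState} (hs : s ∈ m.states) (c x : ℝ) (J : NetState → ℝ) :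
    m.bellmanSum c (fun s => J s - x) s = m.bellmanSum c J s - m.totalRate s * x := by
  have h1 := bellmanSum_le_add hs (J := fun s => J s - x) (J' := J) (x := -x)
    (fun s' hs' => by linarith) c
  have h2 := bellmanSum_le_add hs (J := J) (J' := fun s => J s - x) (x := x)
    (fun s' hs' => by linarith) c
  linarith

theorem empty_mem_states : (⟨0, 0, 0⟩ : NetState) ∈ m.states := by
  rw [mem_states]; simp

theorem sum_rate_mul_abs (β : ℝ) (s : NetState) :
    m.totalRate s * |β / m.totalRate s| = |β| := by
  have := m.totalRate_pos s
  rw [abs_div, abs_of_pos this]; field_simp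

/-- Maximum principle: where `U - φ` is maximal, the Bellman drift of `U` is at most a drift of
`φ`. -/
theorem exists_bellmanSum_sub_le {β : ℝ} {U φ : NetState → ℝ} {s : NetState} (hs : s ∈ m.states)
    (h : ∀ s' ∈ m.states, U s' - φ s' ≤ U s - φ s) :
    ∃ σ, m.IsSelection s σ ∧
      m.bellmanSum (β / m.totalRate s) U s - m.totalRate s * U s ≤
        ∑ E, m.rate s E * (φ (s.next E (σ E)) - φ s) + |β| := by
  obtain ⟨σ, hσ, he⟩ := exists_selection hs (β / m.totalRate s) U
  refine ⟨σ, hσ, ?_⟩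
  rw [he, ← sum_rate_mul_abs β s, ← sum_rate_mul_const, ← sum_rate_mul_const,
    ← Finset.sum_sub_distrib, ← Finset.sum_add_distrib]
  refine Finset.sum_le_sum fun E _ => ?_
  rw [← mul_sub, ← mul_add]
  refine rate_mul_le_rate_mul fun hE => ?_
  have h1 := h _ (hσ E hE).next_mem
  have h2 := neg_abs_le (β / m.totalRate s)
  have h3 := abs_nonneg (β / m.totalRate s)
  simp only [contValue]
  split_ifs <;> linarith

/-- Minimum principle: where `U + φ` is minimal, the Bellman drift of `U` is at least minus a drift
of `φ`. -/
theorem exists_le_bellmanSum_sub {β : ℝ} {U φ : NetState → ℝ} {s : NetState} (hs : s ∈ m.states)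
    (h : ∀ s' ∈ m.states, U s + φ s ≤ U s' + φ s') :
    ∃ σ, m.IsSelection s σ ∧
      -(∑ E, m.rate s E * (φ (s.next E (σ E)) - φ s) + |β|) ≤
      m.bellmanSum (β / m.totalRate s) U s - m.totalRate s * U s := by
  obtain ⟨σ, hσ, -⟩ := exists_selection hs (β / m.totalRate s) U
  refine ⟨σ, hσ, ?_⟩
  have he := hσ.sum_le_bellmanSum (β / m.totalRate s) U
  refine le_trans ?_ (sub_le_sub_right he _)
  rw [← sum_rate_mul_abs β s, ← sum_rate_mul_const, ← sum_rate_mul_const,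
    ← Finset.sum_sub_distrib, ← Finset.sum_add_distrib, ← Finset.sum_neg_distrib]
  refine Finset.sum_le_sum fun E _ => ?_
  rw [← mul_sub, ← mul_add, ← mul_neg]
  refine rate_mul_le_rate_mul fun hE => ?_
  have h1 := h _ (hσ E hE).next_mem
  have h2 := le_abs_self (β / m.totalRate s)
  have h3 := abs_nonneg (β / m.totalRate s)
  simp only [contValue]
  split_ifs <;> linarith

/-! ### A Lyapunov function -/

theorem Feasible.size_next_le {s : NetState} {E : NetEvent} {a : NetAction}
    (h : m.Feasible s E a) :
    (s.next E a).i + (s.next E a).j + (s.next E a).k = s.i + s.j + s.k ∨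
    (s.next E a).i + (s.next E a).j + (s.next E a).k = s.i + s.j + s.k + 1 ∨
    (s.next E a).i + (s.next E a).j + (s.next E a).k + 1 = s.i + s.j + s.k := by
  obtain ⟨i, j, k⟩ := s
  obtain ⟨hs, h⟩ := h
  cases E <;> cases a <;> simp_all [NetState.next] <;> omega

theorem Feasible.size_next_of_departure {s : NetState} {E : NetEvent} {a : NetAction}
    (h : m.Feasible s E a) (h1 : E ≠ .voiceArrival) (h2 : E ≠ .dataArrival) :
    (s.next E a).i + (s.next E a).j + (s.next E a).k + 1 = s.i + s.j + s.k := by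
  obtain ⟨i, j, k⟩ := s
  obtain ⟨hs, h⟩ := h
  cases E <;> cases a <;> simp_all [NetState.next] <;> omega

/-- There is a function of the number of users that decreases at unit rate in every nonempty state,
whatever actions are chosen. -/
theorem exists_lyapunov (m : NetModel) :
    ∃ φ : NetState → ℝ, φ ⟨0, 0, 0⟩ = 0 ∧ ∀ s ∈ m.states, s ≠ ⟨0, 0, 0⟩ →
      ∀ σ, m.IsSelection s σ → ∑ E, m.rate s E * (φ (s.next E (σ E)) - φ s) ≤ -1 := by
  have hlV := m.lamV_pos; have hlD := m.lamD_pos; have hmV := m.muV_pos; have hmD := m.muD_pos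
  obtain ⟨μ, hμ, hμV, hμD⟩ : ∃ μ : ℝ, 0 < μ ∧ μ ≤ m.muV ∧ μ ≤ m.muD :=
    ⟨min m.muV m.muD, lt_min hmV hmD, min_le_left _ _, min_le_right _ _⟩
  obtain ⟨lam, hlam⟩ : ∃ lam, lam = m.lamV + m.lamD := ⟨_, rfl⟩
  have hlam0 : 0 < lam := by rw [hlam]; positivity
  -- The increments of `w` below shrink by the factor `ε` per user. With `lam * ε ≤ μ / 2` the gain
  -- from arrivals is at most half the loss from departures.
  obtain ⟨ε, hε0, hε1, hε2⟩ : ∃ ε : ℝ, 0 < ε ∧ ε ≤ 1 / 2 ∧ lam * ε ≤ μ / 2 := by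
    refine ⟨μ / (2 * (lam + μ)), by positivity, ?_, ?_⟩
    · rw [div_le_div_iff₀ (by positivity) (by positivity)]; linarith
    · rw [mul_div_assoc', div_le_div_iff₀ (by positivity) (by positivity)]; nlinarith
  -- Scaled so that even the smallest relevant increment, with at most `m.C + m.W` users, leaves a
  -- drift of at most `-1`: `(4 / μ) * (1 / 2) * (μ / 2) = 1`.
  set A : ℝ := 4 / (μ * ε ^ (m.C + m.W)) with hA
  have hA0 : 0 < A := by positivity
  set w : ℕ → ℝ := fun x => A * (1 - ε ^ x) with hw
  have hd : ∀ x, w (x + 1) - w x = A * ε ^ x * (1 - ε) := fun x => by simp only [hw]; ring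
  have hd0 : ∀ x, 0 ≤ w (x + 1) - w x := fun x => by
    rw [hd]; exact mul_nonneg (by positivity) (by linarith)
  refine ⟨fun s => w (s.i + s.j + s.k), by simp [hw], fun s hs hs0 σ hσ => ?_⟩
  obtain ⟨x, hx⟩ : ∃ x, s.i + s.j + s.k = x + 1 := by
    refine Nat.exists_eq_succ_of_ne_zero fun h => hs0 ?_
    obtain ⟨i, j, k⟩ := s
    simp only [NetState.mk.injEq] at h ⊢; omega
  have hxN : x ≤ m.C + m.W := by have := (m.mem_states s).1 hs; omega
  have harr : ∀ E, 0 < m.rate s E →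
      w ((s.next E (σ E)).i + (s.next E (σ E)).j + (s.next E (σ E)).k) - w (s.i + s.j + s.k) ≤
        w (x + 2) - w (x + 1) := by
    intro E hE
    have h1 := hd0 (x + 1)
    rcases (hσ E hE).size_next_le with h | h | h
    · rw [h, hx]; linarith
    · rw [h, hx]
    · have h2 := hd0 x
      have h3 : (s.next E (σ E)).i + (s.next E (σ E)).j + (s.next E (σ E)).k = x := by omega
      rw [h3, hx]; linarith
  have hdep : ∀ E, E ≠ .voiceArrival → E ≠ .dataArrival → 0 < m.rate s E →
      w ((s.next E (σ E)).i + (s.next E (σ E)).j + (s.next E (σ E)).k) - w (s.i + s.j + s.k) ≤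
        -(w (x + 1) - w x) := by
    intro E h1 h2 hE
    have h := (hσ E hE).size_next_of_departure h1 h2
    have h3 : (s.next E (σ E)).i + (s.next E (σ E)).j + (s.next E (σ E)).k = x := by omega
    rw [h3, hx]; linarith
  rw [sum_event]
  have e1 := rate_mul_le_rate_mul (harr .voiceArrival)
  have e2 := rate_mul_le_rate_mul (harr .dataArrival)
  have e3 := rate_mul_le_rate_mul (hdep .voiceDepartureLTE (by simp) (by simp))
  have e4 := rate_mul_le_rate_mul (hdep .dataDepartureLTE (by simp) (by simp))
  have e5 := rate_mul_le_rate_mul (hdep .dataDepartureWiFi (by simp) (by simp))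
  have hrate : μ ≤ m.rate s .voiceDepartureLTE + m.rate s .dataDepartureLTE
      + m.rate s .dataDepartureWiFi := by
    have h1 : (s.i : ℝ) * μ ≤ s.i * m.muV := by gcongr
    have h2 : ((s.j : ℝ) + s.k) * μ ≤ (s.j + s.k) * m.muD := by gcongr
    have h3 : (s.i : ℝ) + s.j + s.k = x + 1 := by exact_mod_cast hx
    have h4 : 0 ≤ (x : ℝ) * μ := by positivity
    simp only [rate]
    nlinarith
  have e6 : μ * (w (x + 1) - w x) ≤ (m.rate s .voiceDepartureLTE + m.rate s .dataDepartureLTE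
      + m.rate s .dataDepartureWiFi) * (w (x + 1) - w x) :=
    mul_le_mul_of_nonneg_right hrate (hd0 x)
  have e7 : m.rate s .voiceArrival * (w (x + 2) - w (x + 1))
      + m.rate s .dataArrival * (w (x + 2) - w (x + 1)) = lam * (w (x + 2) - w (x + 1)) := by
    simp only [rate, hlam]; ring
  have e8 : lam * (w (x + 2) - w (x + 1)) - μ * (w (x + 1) - w x) ≤ -1 := by
    have hp : 4 / μ ≤ A * ε ^ x := by
      have : ε ^ (m.C + m.W) ≤ ε ^ x := pow_le_pow_of_le_one hε0.le (by linarith) hxN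
      calc 4 / μ = A * ε ^ (m.C + m.W) := by rw [hA]; field_simp
        _ ≤ A * ε ^ x := by gcongr
    rw [hd (x + 1), hd x, pow_succ]
    have hq : 4 / μ * (1 / 2) ≤ A * ε ^ x * (1 - ε) :=
      mul_le_mul hp (by linarith) (by norm_num) (by positivity)
    have hq' : 4 / μ * (1 / 2) * (μ / 2) = 1 := by field_simp; norm_num
    have hq2 : 4 / μ * (1 / 2) * (μ / 2) ≤ A * ε ^ x * (1 - ε) * (μ / 2) :=
      mul_le_mul_of_nonneg_right hq (by positivity)
    have hq3 : A * ε ^ x * (1 - ε) * (lam * ε) ≤ A * ε ^ x * (1 - ε) * (μ / 2) :=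
      mul_le_mul_of_nonneg_left hε2 (mul_nonneg (by positivity) (by linarith))
    nlinarith
  nlinarith

/-! ### Discounted optimality equation -/

/-- Extension by zero of a function on the state space. -/
def extendStates (U : {s // s ∈ m.states} → ℝ) (s : NetState) : ℝ :=
  if h : s ∈ m.states then U ⟨s, h⟩ else 0

theorem extendStates_apply (U : {s // s ∈ m.states} → ℝ) {s : NetState} (hs : s ∈ m.states) :
    extendStates U s = U ⟨s, hs⟩ := dif_pos hs

theorem abs_extendStates_sub_le (U U' : {s // s ∈ m.states} → ℝ) (s : NetState)
    (hs : s ∈ m.states) : |extendStates U s - extendStates U' s| ≤ dist U U' := by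
  rw [extendStates_apply _ hs, extendStates_apply _ hs, ← Real.dist_eq]
  exact dist_le_pi_dist _ _ _

/-- Unimodality consists of weak inequalities between coordinates, so it passes to fixed points and
subsequential limits. -/
theorem isClosed_wifiUnimodal (kth : ℕ) :
    IsClosed {U : {s // s ∈ m.states} → ℝ | m.WifiUnimodal kth (extendStates U)} := by
  have hc : ∀ s, Continuous fun U : {s // s ∈ m.states} → ℝ => extendStates U s := by
    intro s
    by_cases hs : s ∈ m.states
    · simpa only [extendStates_apply _ hs] using continuous_apply _
    · simp only [extendStates, hs, dite_false]; exact continuous_const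
  simp only [WifiUnimodal, Set.ofPred_forall, Set.ofPred_and]
  refine isClosed_iInter fun i => isClosed_iInter fun j => isClosed_iInter fun k =>
    isClosed_iInter fun _ => isClosed_iInter fun _ => ?_
  exact (isClosed_iInter fun _ => isClosed_le (hc _) (hc _)).inter
    (isClosed_iInter fun _ => isClosed_le (hc _) (hc _))

/-- Uniformization with a rate `L` above all total rates: adding `(L - v) * U` to both sides turns
the equation into a fixed point problem with contraction factor `L / (L + α)` and nonnegative
weights. -/
theorem exists_discounted {kth : ℕ} (hkth : m.IsThreshold kth) (β : ℝ) {α : ℝ} (hα : 0 < α) :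
    ∃ U : NetState → ℝ, m.WifiUnimodal kth U ∧ ∀ s ∈ m.states,
      α * U s = m.throughput s + (m.bellmanSum (β / m.totalRate s) U s - m.totalRate s * U s) := by
  obtain ⟨L, hL0, hL⟩ : ∃ L : ℝ, 0 < L ∧ ∀ s ∈ m.states, m.totalRate s ≤ L :=
    ⟨∑ s ∈ m.states, m.totalRate s,
      Finset.sum_pos (fun s _ => m.totalRate_pos s) ⟨_, empty_mem_states⟩,
      fun s hs => Finset.single_le_sum (f := m.totalRate) (fun s _ => (m.totalRate_pos s).le) hs⟩
  let T : ({s // s ∈ m.states} → ℝ) → ({s // s ∈ m.states} → ℝ) := fun U s =>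
    (L + α)⁻¹ * (m.throughput s.1 + m.bellmanSum (β / m.totalRate s.1) (extendStates U) s.1
      + (L - m.totalRate s.1) * extendStates U s.1)
  have hK : L / (L + α) < 1 := by rw [div_lt_one (by positivity)]; linarith
  have hT : ContractingWith ⟨L / (L + α), div_nonneg hL0.le (add_pos hL0 hα).le⟩ T := by
    refine ⟨hK, LipschitzWith.of_dist_le_mul fun U U' => ?_⟩
    refine (dist_pi_le_iff (mul_nonneg (NNReal.coe_nonneg _) dist_nonneg)).2 fun s => ?_
    have h1 := abs_bellmanSum_sub_le s.2 (abs_extendStates_sub_le U U') (β / m.totalRate s.1)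
    have h2 := mul_le_mul_of_nonneg_left (abs_extendStates_sub_le U U' s.1 s.2)
      (sub_nonneg.2 (hL s.1 s.2))
    have h3 : |(L - m.totalRate s.1) * (extendStates U s.1 - extendStates U' s.1)| ≤
        (L - m.totalRate s.1) * dist U U' := by
      rwa [abs_mul, abs_of_nonneg (sub_nonneg.2 (hL s.1 s.2))]
    rw [Real.dist_eq]
    change _ ≤ L / (L + α) * dist U U'
    simp only [T]
    rw [← mul_sub, abs_mul, abs_of_pos (inv_pos.2 (add_pos hL0 hα)),
      div_eq_inv_mul L, mul_assoc]
    refine mul_le_mul_of_nonneg_left ?_ (inv_pos.2 (add_pos hL0 hα)).le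
    have := abs_add_le
      (m.bellmanSum (β / m.totalRate s.1) (extendStates U) s.1
        - m.bellmanSum (β / m.totalRate s.1) (extendStates U') s.1)
      ((L - m.totalRate s.1) * (extendStates U s.1 - extendStates U' s.1))
    refine le_trans (le_of_eq ?_) (this.trans ?_)
    · congr 1; ring
    · linarith
  have hinv : ∀ U, m.WifiUnimodal kth (extendStates U) → m.WifiUnimodal kth (extendStates (T U)) := by
    intro U hU
    have h1 := (throughput_unimodal hkth).add
      (hU.bellmanSum (c := fun s => β / m.totalRate s) fun i j k => by rw [totalRate_shift])
    have h2 := h1.add (hU.mul (w := fun s => L - m.totalRate s)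
      (fun i j k => by rw [totalRate_shift]) fun s hs => sub_nonneg.2 (hL s hs))
    have h3 := h2.mul (w := fun _ => (L + α)⁻¹) (fun _ _ _ => rfl) fun _ _ => by positivity
    intro i j k hC hW
    have h4 := h3 i j k hC hW
    rw [extendStates_apply (T U) (s := ⟨i, j + 1, k⟩) (by rw [mem_states]; simp only; omega),
      extendStates_apply (T U) (s := ⟨i, j, k + 1⟩) (by rw [mem_states]; simp only; omega)]
    exact h4
  have hfix := hT.fixedPoint_isFixedPt
  set U := hT.fixedPoint
  refine ⟨extendStates U, ?_, fun s hs => ?_⟩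
  -- The fixed point is the limit of the iterates from `0`, which is unimodal.
  · refine (isClosed_wifiUnimodal kth).mem_of_tendsto (hT.tendsto_iterate_fixedPoint 0)
      (Filter.Eventually.of_forall fun n => ?_)
    induction n with
    | zero => intro i j k _ _; simp [extendStates]
    | succ n ih => rw [Function.iterate_succ_apply']; exact hinv _ ih
  · have h := congrFun hfix ⟨s, hs⟩
    rw [← extendStates_apply U hs] at h
    change (L + α)⁻¹ * _ = _ at h
    rw [inv_mul_eq_iff_eq_mul₀ (by positivity)] at h
    simp only at h
    linarith

/-- The extremum principles are used twice: with the zero function they bound `α * U`, and with a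
multiple of the Lyapunov function they bound `U` relative to the empty state. Neither bound depends
on `α`. -/
theorem exists_discounted_bounded {kth : ℕ} (hkth : m.IsThreshold kth) (β : ℝ) :
    ∃ B : ℝ, ∀ α : ℝ, 0 < α → ∃ (g : ℝ) (h : NetState → ℝ), |g| ≤ B ∧
      (∀ s ∈ m.states, |h s| ≤ B) ∧ m.WifiUnimodal kth h ∧ ∀ s ∈ m.states,
        α * h s + g =
          m.throughput s + (m.bellmanSum (β / m.totalRate s) h s - m.totalRate s * h s) := by
  obtain ⟨φ, hφ0, hφ⟩ := exists_lyapunov m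
  have hne : m.states.Nonempty := ⟨_, empty_mem_states⟩
  obtain ⟨K, hK⟩ : ∃ K : ℝ, ∀ s ∈ m.states, |m.throughput s| + |β| ≤ K :=
    ⟨m.states.sup' hne _, fun s hs => Finset.le_sup' (fun s => |m.throughput s| + |β|) hs⟩
  obtain ⟨F, hF⟩ : ∃ F : ℝ, ∀ s ∈ m.states, |φ s| ≤ F :=
    ⟨m.states.sup' hne _, fun s hs => Finset.le_sup' (fun s => |φ s|) hs⟩
  have hK0 : 0 ≤ K := by
    have := hK _ empty_mem_states
    have := abs_nonneg (m.throughput ⟨0, 0, 0⟩)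
    have := abs_nonneg β
    linarith
  have hF0 : 0 ≤ F := (abs_nonneg _).trans (hF _ empty_mem_states)
  refine ⟨K + (2 * K + 1) * F, fun α hα => ?_⟩
  obtain ⟨U, hU, hUeq⟩ := exists_discounted hkth β hα
  have hup : ∀ s ∈ m.states, α * U s ≤ K := by
    obtain ⟨s₀, hs₀, hmax⟩ := m.states.exists_max_image U hne
    obtain ⟨σ, -, hσ⟩ := exists_bellmanSum_sub_le (β := β) (U := U) (φ := fun _ => 0) hs₀
      (by simpa using hmax)
    intro s hs
    have h1 := mul_le_mul_of_nonneg_left (hmax s hs) hα.le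
    have h2 := hUeq s₀ hs₀
    have h3 := hK s₀ hs₀
    have h4 := le_abs_self (m.throughput s₀)
    simp only [sub_self, mul_zero, Finset.sum_const_zero, zero_add] at hσ
    linarith
  have hlo : ∀ s ∈ m.states, -K ≤ α * U s := by
    obtain ⟨s₀, hs₀, hmin⟩ := m.states.exists_min_image U hne
    obtain ⟨σ, -, hσ⟩ := exists_le_bellmanSum_sub (β := β) (U := U) (φ := fun _ => 0) hs₀
      (by simpa using hmin)
    intro s hs
    have h1 := mul_le_mul_of_nonneg_left (hmin s hs) hα.le
    have h2 := hUeq s₀ hs₀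
    have h3 := hK s₀ hs₀
    have h4 := neg_abs_le (m.throughput s₀)
    simp only [sub_self, mul_zero, Finset.sum_const_zero, zero_add] at hσ
    linarith
  -- If `U - c * φ` were maximal only at a nonempty state, the drift `-c` would force `α * U ≤ K - c
  -- < -K` there, against `hlo`. The lower bound is symmetric.
  set c : ℝ := 2 * K + 1 with hc
  have hsum : ∀ (s : NetState) (σ : NetEvent → NetAction),
      ∑ E, m.rate s E * (c * φ (s.next E (σ E)) - c * φ s) =
        c * ∑ E, m.rate s E * (φ (s.next E (σ E)) - φ s) := by
    intro s σ; rw [Finset.mul_sum]; exact Finset.sum_congr rfl fun E _ => by ring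
  have hup' : ∀ s ∈ m.states, U s - U ⟨0, 0, 0⟩ ≤ c * φ s := by
    obtain ⟨s₀, hs₀, hmax⟩ := m.states.exists_max_image (fun s => U s - c * φ s) hne
    obtain ⟨σ, hsel, hσ⟩ := exists_bellmanSum_sub_le (β := β) (U := U) (φ := fun s => c * φ s) hs₀
      hmax
    by_cases h0 : s₀ = ⟨0, 0, 0⟩
    · intro s hs
      have := hmax s hs
      simp only [h0, hφ0, mul_zero, sub_zero] at this
      linarith
    · exfalso
      have h1 := hφ s₀ hs₀ h0 σ hsel
      rw [hsum] at hσ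
      have h2 := hUeq s₀ hs₀
      have h3 := hK s₀ hs₀
      have h4 := le_abs_self (m.throughput s₀)
      have h5 := hlo s₀ hs₀
      have h6 := mul_le_mul_of_nonneg_left h1 (by positivity : 0 ≤ c)
      linarith
  have hlo' : ∀ s ∈ m.states, -(c * φ s) ≤ U s - U ⟨0, 0, 0⟩ := by
    obtain ⟨s₀, hs₀, hmin⟩ := m.states.exists_min_image (fun s => U s + c * φ s) hne
    obtain ⟨σ, hsel, hσ⟩ := exists_le_bellmanSum_sub (β := β) (U := U) (φ := fun s => c * φ s) hs₀
      hmin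
    by_cases h0 : s₀ = ⟨0, 0, 0⟩
    · intro s hs
      have := hmin s hs
      simp only [h0, hφ0, mul_zero, add_zero] at this
      linarith
    · exfalso
      have h1 := hφ s₀ hs₀ h0 σ hsel
      rw [hsum] at hσ
      have h2 := hUeq s₀ hs₀
      have h3 := hK s₀ hs₀
      have h4 := neg_abs_le (m.throughput s₀)
      have h5 := hup s₀ hs₀
      have h6 := mul_le_mul_of_nonneg_left h1 (by positivity : 0 ≤ c)
      linarith
  have hcF : 0 ≤ c * F := by positivity
  refine ⟨α * U ⟨0, 0, 0⟩, fun s => U s - U ⟨0, 0, 0⟩, ?_, fun s hs => ?_, ?_, fun s hs => ?_⟩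
  · rw [abs_le]
    have := hup _ empty_mem_states; have := hlo _ empty_mem_states
    constructor <;> linarith
  · have h1 : c * φ s ≤ c * F :=
      mul_le_mul_of_nonneg_left ((le_abs_self _).trans (hF s hs)) (by positivity)
    have := hup' s hs; have := hlo' s hs
    rw [abs_le]
    constructor <;> linarith
  · intro i j k hC hW
    exact ⟨fun hk => sub_le_sub_right ((hU i j k hC hW).1 hk) _,
      fun hk => sub_le_sub_right ((hU i j k hC hW).2 hk) _⟩
  · rw [bellmanSum_sub_const hs]
    have := hUeq s hs
    linarith

/-- The average-reward optimality equation has a unimodal solution. -/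
theorem exists_averageOptimality {kth : ℕ} (hkth : m.IsThreshold kth) (β : ℝ) :
    ∃ (g : ℝ) (h : NetState → ℝ), m.WifiUnimodal kth h ∧ ∀ s ∈ m.states,
      g = m.throughput s + (m.bellmanSum (β / m.totalRate s) h s - m.totalRate s * h s) := by
  obtain ⟨B, hB⟩ := exists_discounted_bounded hkth β
  -- Discount rates `1 / (n + 1)`; since the `h n` stay bounded, the term `α * h` vanishes in the
  -- limit.
  have hpos : ∀ n : ℕ, (0 : ℝ) < 1 / ((n : ℝ) + 1) := fun n => by positivity
  choose g h hg hh huni heq using fun n : ℕ => hB _ (hpos n)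
  let H : ℕ → {s // s ∈ m.states} → ℝ := fun n s => h n s.1
  have hB0 : 0 ≤ B := (abs_nonneg _).trans (hg 0)
  have hmem : ∀ n, (g n, H n) ∈ Metric.closedBall (0 : ℝ × ({s // s ∈ m.states} → ℝ)) B := by
    intro n
    rw [mem_closedBall_zero_iff, Prod.norm_def]
    refine max_le (hg n) ((pi_norm_le_iff_of_nonneg hB0).2 fun s => hh n s.1 s.2)
  obtain ⟨⟨g₀, H₀⟩, -, ψ, hψ, hlim⟩ :=
    tendsto_subseq_of_bounded Metric.isBounded_closedBall hmem
  have hlg : Filter.Tendsto (fun n => g (ψ n)) Filter.atTop (nhds g₀) :=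
    (continuous_fst.tendsto _).comp hlim
  have hlH : Filter.Tendsto (fun n => H (ψ n)) Filter.atTop (nhds H₀) :=
    (continuous_snd.tendsto _).comp hlim
  have hlα : Filter.Tendsto (fun n => 1 / ((ψ n : ℝ) + 1)) Filter.atTop (nhds 0) :=
    (tendsto_one_div_add_atTop_nhds_zero_nat (𝕜 := ℝ)).comp hψ.tendsto_atTop
  have hext : ∀ n, ∀ s ∈ m.states, extendStates (H n) s = h n s :=
    fun n s hs => extendStates_apply _ hs
  refine ⟨g₀, extendStates H₀, ?_, fun s hs => ?_⟩
  · refine (isClosed_wifiUnimodal kth).mem_of_tendsto hlH (Filter.Eventually.of_forall fun n => ?_)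
    intro i j k hC hW
    rw [hext _ ⟨i, j + 1, k⟩ (by rw [mem_states]; simp only; omega),
      hext _ ⟨i, j, k + 1⟩ (by rw [mem_states]; simp only; omega)]
    exact huni (ψ n) i j k hC hW
  · have hls : Filter.Tendsto (fun n => h (ψ n) s) Filter.atTop (nhds (extendStates H₀ s)) := by
      rw [extendStates_apply _ hs]
      exact ((continuous_apply (⟨s, hs⟩ : {s // s ∈ m.states})).tendsto _).comp hlH
    have hlb : Filter.Tendsto (fun n => m.bellmanSum (β / m.totalRate s) (h (ψ n)) s) Filter.atTop
        (nhds (m.bellmanSum (β / m.totalRate s) (extendStates H₀) s)) := by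
      rw [tendsto_iff_dist_tendsto_zero]
      have hd := (tendsto_iff_dist_tendsto_zero.1 hlH).const_mul (m.totalRate s)
      rw [mul_zero] at hd
      refine squeeze_zero (fun _ => dist_nonneg) (fun n => ?_) hd
      rw [Real.dist_eq]
      refine abs_bellmanSum_sub_le hs (fun s' hs' => ?_) _
      rw [← hext _ s' hs']
      exact abs_extendStates_sub_le _ _ s' hs'
    have hl := (hlα.mul hls).add hlg
    have hr := (hlb.sub (hls.const_mul (m.totalRate s))).const_add (m.throughput s)
    rw [zero_mul, zero_add] at hl
    refine tendsto_nhds_unique hl (hr.congr fun n => ?_)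
    exact (heq (ψ n) s hs).symm

end NetModel

/-! ### Exponentials of generators of finite Markov chains -/

namespace Matrix

open scoped Norms.Operator

variable {ι : Type*} [Fintype ι] [DecidableEq ι]

theorem pow_nonneg_apply {A : Matrix ι ι ℝ} (hA : ∀ x y, 0 ≤ A x y) (n : ℕ) (x y : ι) :
    0 ≤ (A ^ n) x y := by
  induction n generalizing x y with
  | zero => rw [pow_zero, one_apply]; split_ifs <;> norm_num
  | succ n ih =>
    rw [pow_succ, mul_apply]
    exact Finset.sum_nonneg fun z _ => mul_nonneg (ih x z) (hA z y)

theorem hasSum_exp_apply (A : Matrix ι ι ℝ) (x y : ι) :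
    HasSum (fun n : ℕ => (n.factorial : ℝ)⁻¹ * (A ^ n) x y) (NormedSpace.exp A x y) := by
  have h := NormedSpace.exp_series_hasSum_exp' (𝕂 := ℝ) A
  exact h.map (AddMonoidHom.mk' (fun B : Matrix ι ι ℝ => B x y) fun _ _ => rfl)
    ((continuous_apply y).comp (continuous_apply x))

theorem inv_factorial_mul_pow_le_exp {A : Matrix ι ι ℝ} (hA : ∀ x y, 0 ≤ A x y) (n : ℕ)
    (x y : ι) : (n.factorial : ℝ)⁻¹ * (A ^ n) x y ≤ NormedSpace.exp A x y :=
  le_hasSum (hasSum_exp_apply A x y) n fun k _ =>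
    mul_nonneg (by positivity) (pow_nonneg_apply hA k x y)

theorem exp_nonneg_apply {A : Matrix ι ι ℝ} (hA : ∀ x y, 0 ≤ A x y) (x y : ι) :
    0 ≤ NormedSpace.exp A x y :=
  (hasSum_exp_apply A x y).nonneg fun n => mul_nonneg (by positivity) (pow_nonneg_apply hA n x y)

/-- A multiple of the identity commutes with everything. Shifting a generator to a nonnegative
matrix makes positivity of its exponential visible in the power series. -/
theorem exp_add_smul_one (A : Matrix ι ι ℝ) (c : ℝ) :
    NormedSpace.exp A = Real.exp (-c) • NormedSpace.exp (A + c • 1) := by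
  have h1 : A = (-c) • (1 : Matrix ι ι ℝ) + (A + c • 1) := by simp
  have h2 : Commute ((-c) • (1 : Matrix ι ι ℝ)) (A + c • 1) := (Commute.one_left _).smul_left _
  have h3 : NormedSpace.exp ((-c) • (1 : Matrix ι ι ℝ)) = Real.exp (-c) • 1 := by
    rw [smul_one_eq_diagonal, exp_diagonal, smul_one_eq_diagonal]
    congr 1
    ext i
    rw [Pi.coe_exp, Real.exp_eq_exp_ℝ]
  conv_lhs => rw [h1]
  rw [exp_add_of_commute _ _ h2, h3, smul_mul_assoc, one_mul]

/-- Off-diagonal entries are nonnegative and rows sum to zero. -/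
structure IsGenerator (Q : Matrix ι ι ℝ) : Prop where
  offDiag_nonneg : ∀ x y, x ≠ y → 0 ≤ Q x y
  row_sum : ∀ x, ∑ y, Q x y = 0

/-- A multiple of the identity that makes a generator entrywise nonnegative. -/
theorem IsGenerator.exists_add_smul_nonneg {Q : Matrix ι ι ℝ} (hQ : Q.IsGenerator) :
    ∃ c : ℝ, ∀ x y, 0 ≤ (Q + c • (1 : Matrix ι ι ℝ)) x y := by
  refine ⟨∑ x, |Q x x|, fun x y => ?_⟩
  rw [add_apply, smul_apply, one_apply]
  split_ifs with h
  · subst h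
    have h1 := Finset.single_le_sum (f := fun x => |Q x x|) (fun _ _ => abs_nonneg _)
      (Finset.mem_univ x)
    have h2 := neg_abs_le (Q x x)
    rw [smul_eq_mul, mul_one]; linarith
  · simpa using hQ.offDiag_nonneg x y h

theorem IsGenerator.exp_nonneg {Q : Matrix ι ι ℝ} (hQ : Q.IsGenerator) {t : ℝ} (ht : 0 ≤ t)
    (x y : ι) : 0 ≤ NormedSpace.exp (t • Q) x y := by
  obtain ⟨c, hc⟩ := hQ.exists_add_smul_nonneg
  rw [exp_add_smul_one _ (t * c), smul_apply]
  refine smul_nonneg (Real.exp_pos _).le (exp_nonneg_apply (fun x y => ?_) x y)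
  rw [mul_smul, ← smul_add, smul_apply]
  exact smul_nonneg ht (hc x y)

theorem hasDerivAt_exp_smul_mulVec (Q : Matrix ι ι ℝ) (h : ι → ℝ) (x : ι) (t : ℝ) :
    HasDerivAt (fun u : ℝ => (NormedSpace.exp (u • Q) *ᵥ h) x)
      ((NormedSpace.exp (t • Q) *ᵥ (Q *ᵥ h)) x) t := by
  have h1 := hasDerivAt_exp_smul_const Q t
  let L : Matrix ι ι ℝ →ₗ[ℝ] ℝ :=
    { toFun := fun A => (A *ᵥ h) x
      map_add' := fun A B => by rw [add_mulVec]; rfl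
      map_smul' := fun c A => by rw [smul_mulVec]; rfl }
  have h2 := (LinearMap.toContinuousLinearMap L).hasFDerivAt.comp_hasDerivAt t h1
  rw [mulVec_mulVec]
  exact h2

theorem continuous_exp_smul_mulVec (Q : Matrix ι ι ℝ) (h : ι → ℝ) (x : ι) :
    Continuous (fun u : ℝ => (NormedSpace.exp (u • Q) *ᵥ h) x) :=
  continuous_iff_continuousAt.2 fun t => (hasDerivAt_exp_smul_mulVec Q h x t).continuousAt

theorem integral_exp_smul_mulVec (Q : Matrix ι ι ℝ) (h : ι → ℝ) (x : ι) (t : ℝ) :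
    ∫ u in (0 : ℝ)..t, (NormedSpace.exp (u • Q) *ᵥ (Q *ᵥ h)) x =
      (NormedSpace.exp (t • Q) *ᵥ h) x - h x := by
  rw [intervalIntegral.integral_eq_sub_of_hasDerivAt
    (fun u _ => hasDerivAt_exp_smul_mulVec Q h x u)
    ((continuous_exp_smul_mulVec Q _ x).intervalIntegrable _ _)]
  simp

/-- A generator annihilates constants, so the transition matrices fix them. -/
theorem IsGenerator.exp_mulVec_const {Q : Matrix ι ι ℝ} (hQ : Q.IsGenerator) (t g : ℝ) (x : ι) :
    (NormedSpace.exp (t • Q) *ᵥ fun _ => g) x = g := by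
  have h0 : Q *ᵥ (fun _ => g) = 0 := by
    ext y; simp [mulVec, dotProduct, ← Finset.sum_mul, hQ.row_sum]
  have h := integral_exp_smul_mulVec Q (fun _ => g) x t
  simp only [h0, mulVec_zero, Pi.zero_apply, intervalIntegral.integral_zero] at h
  linarith

theorem IsGenerator.exp_mulVec_mono {Q : Matrix ι ι ℝ} (hQ : Q.IsGenerator) {t : ℝ} (ht : 0 ≤ t)
    {h h' : ι → ℝ} (hh : ∀ y, h y ≤ h' y) (x : ι) :
    (NormedSpace.exp (t • Q) *ᵥ h) x ≤ (NormedSpace.exp (t • Q) *ᵥ h') x :=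
  Finset.sum_le_sum fun y _ => mul_le_mul_of_nonneg_left (hh y) (hQ.exp_nonneg ht x y)

theorem IsGenerator.abs_exp_mulVec_le {Q : Matrix ι ι ℝ} (hQ : Q.IsGenerator) {t : ℝ} (ht : 0 ≤ t)
    {h : ι → ℝ} {B : ℝ} (hB : ∀ y, |h y| ≤ B) (x : ι) :
    |(NormedSpace.exp (t • Q) *ᵥ h) x| ≤ B := by
  have h1 := hQ.exp_mulVec_mono ht (h := h) (h' := fun _ => B) (fun y => (abs_le.1 (hB y)).2) x
  have h2 := hQ.exp_mulVec_mono ht (h := fun _ => -B) (h' := h) (fun y => (abs_le.1 (hB y)).1) x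
  rw [hQ.exp_mulVec_const] at h1 h2
  exact abs_le.2 ⟨h2, h1⟩

/-- Dynkin's formula for a reward `r` with gain `g`, relative value `h` and defect `d`. -/
theorem IsGenerator.integral_reward {Q : Matrix ι ι ℝ} (hQ : Q.IsGenerator) {r h d : ι → ℝ} {g : ℝ}
    (hr : ∀ y, r y + (Q *ᵥ h) y + d y = g) (x : ι) (t : ℝ) :
    ∫ u in (0 : ℝ)..t, (NormedSpace.exp (u • Q) *ᵥ r) x =
      g * t - ((NormedSpace.exp (t • Q) *ᵥ h) x - h x)
        - ∫ u in (0 : ℝ)..t, (NormedSpace.exp (u • Q) *ᵥ d) x := by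
  have hr' : r = (fun _ => g) - Q *ᵥ h - d := by
    ext y; simp only [Pi.sub_apply]; linarith [hr y]
  have he : ∀ u : ℝ, (NormedSpace.exp (u • Q) *ᵥ r) x =
      g - (NormedSpace.exp (u • Q) *ᵥ (Q *ᵥ h)) x - (NormedSpace.exp (u • Q) *ᵥ d) x := by
    intro u
    rw [hr', mulVec_sub, mulVec_sub, Pi.sub_apply, Pi.sub_apply, hQ.exp_mulVec_const]
  have c1 := (continuous_exp_smul_mulVec Q (Q *ᵥ h) x).intervalIntegrable
    (μ := MeasureTheory.volume) 0 t
  have c2 := (continuous_exp_smul_mulVec Q d x).intervalIntegrable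
    (μ := MeasureTheory.volume) 0 t
  simp only [he]
  rw [intervalIntegral.integral_sub (intervalIntegrable_const.sub c1) c2,
    intervalIntegral.integral_sub intervalIntegrable_const c1, integral_exp_smul_mulVec]
  simp [mul_comm]

/-- Entries of the transition matrix at time `1` are positive along paths of the chain. -/
theorem IsGenerator.exp_pos_of_path {Q : Matrix ι ι ℝ} (hQ : Q.IsGenerator) {x y : ι}
    (h : Relation.ReflTransGen (fun x y => x ≠ y ∧ 0 < Q x y) x y) :
    0 < NormedSpace.exp Q x y := by
  obtain ⟨c, hc⟩ := hQ.exists_add_smul_nonneg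
  have hpow : ∃ n : ℕ, 0 < ((Q + c • (1 : Matrix ι ι ℝ)) ^ n) x y := by
    induction h with
    | refl => exact ⟨0, by simp⟩
    | @tail y z _ hyz ih =>
      obtain ⟨n, hn⟩ := ih
      refine ⟨n + 1, ?_⟩
      rw [pow_succ, mul_apply]
      refine Finset.sum_pos' (fun w _ => mul_nonneg (pow_nonneg_apply hc n x w) (hc w z))
        ⟨y, Finset.mem_univ y, mul_pos hn ?_⟩
      simpa [add_apply, smul_apply, one_apply, hyz.1] using hyz.2
  obtain ⟨n, hn⟩ := hpow
  rw [exp_add_smul_one _ c, smul_apply]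
  exact smul_pos (Real.exp_pos _)
    ((mul_pos (by positivity) hn).trans_le (inv_factorial_mul_pow_le_exp hc n x y))

/-- A state accessible from everywhere has transition probabilities bounded below at all times
`t ≥ 1`. -/
theorem IsGenerator.exists_le_exp {Q : Matrix ι ι ℝ} (hQ : Q.IsGenerator) {y : ι}
    (h : ∀ x, Relation.ReflTransGen (fun x y => x ≠ y ∧ 0 < Q x y) x y) :
    ∃ η : ℝ, 0 < η ∧ ∀ t : ℝ, 1 ≤ t → ∀ x, η ≤ NormedSpace.exp (t • Q) x y := by
  obtain ⟨z, -, hz⟩ := Finset.univ.exists_min_image (fun x => NormedSpace.exp Q x y)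
    ⟨y, Finset.mem_univ y⟩
  refine ⟨NormedSpace.exp Q z y, hQ.exp_pos_of_path (h z), fun t ht x => ?_⟩
  -- The entry at time `t` is an average, over the state at time `t - 1`, of time-one entries that
  -- are all at least the minimum at `z`.
  have h1 : t • Q = (t - 1) • Q + Q := by rw [sub_smul, one_smul, sub_add_cancel]
  have h2 : Commute ((t - 1) • Q) Q := (Commute.refl Q).smul_left _
  rw [h1, exp_add_of_commute _ _ h2]
  have h3 := hQ.exp_mulVec_mono (sub_nonneg.2 ht) (h := fun _ => NormedSpace.exp Q z y)
    (h' := fun w => NormedSpace.exp Q w y) (fun w => hz w (Finset.mem_univ w)) x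
  rw [hQ.exp_mulVec_const] at h3
  exact h3

end Matrix

namespace NetModel

open Matrix

variable {m : NetModel}

/-! ### Generators of policies -/

namespace Policy

variable (M : m.Policy)

theorem sum_prob_mul {s : NetState} (hs : s ∈ m.states) (E : NetEvent) (x : ℝ) :
    m.rate s E * ∑ a, M.prob s E a * x = m.rate s E * x := by
  rcases (m.rate_nonneg s E).eq_or_lt with h0 | h0
  · simp [← h0]
  · rw [← Finset.sum_mul, M.sum_one s hs E h0, one_mul]

theorem exists_prob_pos {s : NetState} (hs : s ∈ m.states) {E : NetEvent} (hE : 0 < m.rate s E) :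
    ∃ a, 0 < M.prob s E a := by
  by_contra! h
  have := M.sum_one s hs E hE
  have h2 := Finset.sum_nonpos fun a (_ : a ∈ Finset.univ) => h a
  linarith

theorem feasible_of_pos {s : NetState} {E : NetEvent} {a : NetAction} (h : 0 < M.prob s E a) :
    m.Feasible s E a := M.feasible s E a h.ne'

theorem prob_eq_one {s : NetState} (hs : s ∈ m.states) {E : NetEvent} (hE : 0 < m.rate s E)
    {a : NetAction} (h : ∀ a', a' ≠ a → ¬ 0 < M.prob s E a') : M.prob s E a = 1 := by
  rw [← M.sum_one s hs E hE]
  exact (Finset.sum_eq_single a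
    (fun a' _ ha' => le_antisymm (not_lt.1 (h a' ha')) (M.nonneg s E a')) (by simp)).symm

theorem sum_ite_config {s : NetState} {E : NetEvent} {a : NetAction} (G : NetState → Bool → ℝ) :
    ∑ y : m.Config, m.rate s E * M.prob s E a *
      (if s.next E a = y.1.1 ∧ blocksVoice E a = y.2 then 1 else 0) * G y.1.1 y.2 =
      m.rate s E * M.prob s E a * G (s.next E a) (blocksVoice E a) := by
  by_cases h0 : M.prob s E a = 0
  · simp [h0]
  · rw [Finset.sum_eq_single (⟨⟨s.next E a, (M.feasible s E a h0).next_mem⟩, blocksVoice E a⟩ :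
      m.Config)]
    · simp
    · rintro ⟨⟨s', hs'⟩, b⟩ - hne
      rw [if_neg]
      · simp
      · rintro ⟨h1, h2⟩
        refine hne ?_
        simp only at h1 h2
        subst h1 h2
        rfl
    · simp

theorem generator_mulVec (G : NetState → Bool → ℝ) (x : m.Config) :
    (M.generator *ᵥ fun y => G y.1.1 y.2) x =
      ∑ E, ∑ a, m.rate x.1.1 E * M.prob x.1.1 E a * G (x.1.1.next E a) (blocksVoice E a)
        - m.totalRate x.1.1 * G x.1.1 x.2 := by
  simp only [mulVec, dotProduct, generator, sub_mul, Finset.sum_sub_distrib, Finset.sum_mul]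
  congr 1
  · rw [Finset.sum_comm]
    refine Finset.sum_congr rfl fun E _ => ?_
    rw [Finset.sum_comm]
    exact Finset.sum_congr rfl fun a _ => M.sum_ite_config G
  · simp [ite_mul]

theorem isGenerator : M.generator.IsGenerator where
  offDiag_nonneg x y h := by
    simp only [generator, if_neg h, sub_zero]
    exact Finset.sum_nonneg fun E _ => Finset.sum_nonneg fun a _ =>
      mul_nonneg (mul_nonneg (m.rate_nonneg _ _) (M.nonneg _ _ _)) (by split_ifs <;> norm_num)
  row_sum x := by
    have h := M.generator_mulVec (fun _ _ => 1) x
    simp only [mulVec, dotProduct, mul_one] at h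
    rw [h, sub_eq_zero, totalRate]
    refine Finset.sum_congr rfl fun E _ => ?_
    have := M.sum_prob_mul x.1.2 E 1
    simpa only [mul_one, Finset.mul_sum] using this

theorem generator_pos {s : NetState} (hs : s ∈ m.states) (b : Bool) {E : NetEvent} {a : NetAction}
    (hE : 0 < m.rate s E) (ha : 0 < M.prob s E a) {s' : NetState} (hs' : s' ∈ m.states)
    (he : s.next E a = s') (hne : (s, b) ≠ (s', blocksVoice E a)) :
    0 < M.generator (⟨s, hs⟩, b) (⟨s', hs'⟩, blocksVoice E a) := by
  have hne' : ((⟨s, hs⟩, b) : m.Config) ≠ (⟨s', hs'⟩, blocksVoice E a) := by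
    intro h
    simp only [Prod.mk.injEq, Subtype.mk.injEq] at h
    exact hne (Prod.ext h.1 h.2)
  simp only [generator, if_neg hne', sub_zero]
  have h0 : ∀ E' a', 0 ≤ m.rate s E' * M.prob s E' a' *
      (if s.next E' a' = s' ∧ blocksVoice E' a' = blocksVoice E a then (1 : ℝ) else 0) :=
    fun E' a' => mul_nonneg (mul_nonneg (m.rate_nonneg _ _) (M.nonneg _ _ _))
      (by split_ifs <;> norm_num)
  refine Finset.sum_pos' (fun E' _ => Finset.sum_nonneg fun a' _ => h0 E' a')
    ⟨E, Finset.mem_univ E, Finset.sum_pos' (fun a' _ => h0 E a') ⟨a, Finset.mem_univ a, ?_⟩⟩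
  rw [if_pos ⟨he, rfl⟩, mul_one]
  exact mul_pos hE ha

/-! ### Accessibility -/

/-- One transition of the chain to a different configuration. -/
def Step (x y : m.Config) : Prop := x ≠ y ∧ 0 < M.generator x y

theorem exists_path_step {s : NetState} (hs : s ∈ m.states) (b : Bool) {E : NetEvent}
    {a : NetAction} (hE : 0 < m.rate s E) (ha : 0 < M.prob s E a)
    (hs' : s.next E a ∈ m.states) :
    Relation.ReflTransGen M.Step (⟨s, hs⟩, b) (⟨s.next E a, hs'⟩, blocksVoice E a) := by
  by_cases hne : ((⟨s, hs⟩, b) : m.Config) = (⟨s.next E a, hs'⟩, blocksVoice E a)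
  · rw [hne]
  · refine Relation.ReflTransGen.single ⟨hne, M.generator_pos hs b hE ha hs' rfl fun h => hne ?_⟩
    simp only [Prod.mk.injEq] at h
    exact Prod.ext (Subtype.ext h.1) h.2

/-- Departures empty the system one user at a time and clear the flag. The only exception is the
empty state with the flag still set, which has no departures; `hb` excludes it. -/
theorem path_empty_of_size (n : ℕ) (s : NetState) (hs : s ∈ m.states) (b : Bool)
    (hn : s.i + s.j + s.k = n) (hb : n ≠ 0 ∨ b = false) :
    Relation.ReflTransGen M.Step (⟨s, hs⟩, b) (⟨⟨0, 0, 0⟩, empty_mem_states⟩, false) := by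
  induction n generalizing s b with
  | zero =>
    obtain ⟨i, j, k⟩ := s
    simp only at hn
    obtain ⟨rfl, rfl, rfl⟩ : i = 0 ∧ j = 0 ∧ k = 0 := by omega
    obtain rfl : b = false := by simpa using hb
    rfl
  | succ n ih =>
    obtain ⟨E, h1, h2, hE⟩ : ∃ E, E ≠ .voiceArrival ∧ E ≠ .dataArrival ∧ 0 < m.rate s E := by
      obtain ⟨e1, e2, e3⟩ := m.rate_departure_pos (s := s)
      rcases (by omega : 0 < s.i ∨ 0 < s.j ∨ 0 < s.k) with h | h | h
      · exact ⟨_, by simp, by simp, e1.2 h⟩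
      · exact ⟨_, by simp, by simp, e2.2 h⟩
      · exact ⟨_, by simp, by simp, e3.2 h⟩
    obtain ⟨a, ha⟩ := M.exists_prob_pos hs hE
    have hf := M.feasible_of_pos ha
    have hsz := hf.size_next_of_departure h1 h2
    have hblock : blocksVoice E a = false := by cases E <;> simp_all [blocksVoice]
    refine (M.exists_path_step hs b hE ha hf.next_mem).trans ?_
    exact ih _ hf.next_mem _ (by omega) (Or.inr hblock)

/-- The empty configuration is accessible from every configuration. -/
theorem path_empty (x : m.Config) :
    Relation.ReflTransGen M.Step x (⟨⟨0, 0, 0⟩, empty_mem_states⟩, false) := by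
  obtain ⟨⟨s, hs⟩, b⟩ := x
  by_cases h0 : s.i + s.j + s.k = 0
  -- Blocking is infeasible in the empty state, so an arriving voice user is admitted, and its
  -- departure then leaves the flag cleared.
  · have hE : 0 < m.rate s .voiceArrival := m.lamV_pos
    obtain ⟨a, ha⟩ := M.exists_prob_pos hs hE
    have hf := M.feasible_of_pos ha
    refine (M.exists_path_step hs b hE ha hf.next_mem).trans ?_
    refine M.path_empty_of_size 1 _ hf.next_mem _ ?_ (Or.inl one_ne_zero)
    obtain ⟨i, j, k⟩ := s
    obtain ⟨-, hf⟩ := hf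
    simp only at h0
    obtain ⟨rfl, rfl, rfl⟩ : i = 0 ∧ j = 0 ∧ k = 0 := by omega
    cases a <;> simp_all [NetState.next]
  · exact M.path_empty_of_size _ s hs b rfl (Or.inl h0)

theorem Reachable.exists_path {M : m.Policy} {s : NetState} (h : M.Reachable s) :
    ∃ (hs : s ∈ m.states) (b : Bool),
      ∀ x, Relation.ReflTransGen M.Step x (⟨s, hs⟩, b) := by
  induction h with
  | empty => exact ⟨empty_mem_states, false, M.path_empty⟩
  | step s E a _ hE ha ih =>
    obtain ⟨hs, b, hp⟩ := ih
    exact ⟨(M.feasible_of_pos ha).next_mem, _, fun x =>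
      (hp x).trans (M.exists_path_step hs b hE ha _)⟩

/-! ### Long-run averages and the optimality equation -/

/-- How much the policy loses, per unit time, against the best continuation values. -/
noncomputable def defect (β : ℝ) (h : NetState → ℝ) (s : NetState) : ℝ :=
  ∑ E, m.rate s E * (m.bestValue (β / m.totalRate s) h s E
    - ∑ a, M.prob s E a * contValue (β / m.totalRate s) h s E a)

theorem rate_mul_loss_nonneg {s : NetState} (hs : s ∈ m.states) (E : NetEvent) (c : ℝ)
    (h : NetState → ℝ) :
    0 ≤ m.rate s E * (m.bestValue c h s E - ∑ a, M.prob s E a * contValue c h s E a) := by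
  rw [mul_sub, ← M.sum_prob_mul hs E (m.bestValue c h s E), ← mul_sub, ← Finset.sum_sub_distrib]
  refine mul_nonneg (m.rate_nonneg s E) (Finset.sum_nonneg fun a _ => ?_)
  rw [← mul_sub]
  rcases (M.nonneg s E a).eq_or_lt with h0 | h0
  · simp [← h0]
  · exact mul_nonneg h0.le (sub_nonneg.2 (contValue_le_bestValue (M.feasible_of_pos h0)))

theorem defect_nonneg (β : ℝ) (h : NetState → ℝ) {s : NetState} (hs : s ∈ m.states) :
    0 ≤ M.defect β h s :=
  Finset.sum_nonneg fun E _ => M.rate_mul_loss_nonneg hs E _ h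

/-- The defect is a sum of nonnegative losses over events and actions, so each of them vanishes. -/
theorem contValue_eq_of_defect_eq_zero {β : ℝ} {h : NetState → ℝ} {s : NetState}
    (hs : s ∈ m.states) (hd : M.defect β h s = 0) {E : NetEvent} (hE : 0 < m.rate s E)
    {a : NetAction} (ha : 0 < M.prob s E a) :
    contValue (β / m.totalRate s) h s E a = m.bestValue (β / m.totalRate s) h s E := by
  have h1 := (Finset.sum_eq_zero_iff_of_nonneg
    fun E _ => M.rate_mul_loss_nonneg hs E (β / m.totalRate s) h).1 hd E (Finset.mem_univ E)
  rw [mul_sub, ← M.sum_prob_mul hs E (m.bestValue _ h s E), ← mul_sub, ← Finset.sum_sub_distrib]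
    at h1
  have h2 := (mul_eq_zero.1 h1).resolve_left hE.ne'
  have h3 := (Finset.sum_eq_zero_iff_of_nonneg fun a _ => by
    rw [← mul_sub]
    rcases (M.nonneg s E a).eq_or_lt with h0 | h0
    · simp [← h0]
    · exact mul_nonneg h0.le (sub_nonneg.2 (contValue_le_bestValue (M.feasible_of_pos h0)))).1 h2 a
    (Finset.mem_univ a)
  rw [← mul_sub] at h3
  linarith [(mul_eq_zero.1 h3).resolve_left ha.ne']

/-- Relative value of a configuration: the state value, reduced by the expected blocking cost until
the next event. -/
noncomputable def configValue (m : NetModel) (β : ℝ) (h : NetState → ℝ) (s : NetState)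
    (b : Bool) : ℝ := h s - if b then β / m.totalRate s else 0

theorem configValue_next (β : ℝ) (h : NetState → ℝ) (s : NetState) (E : NetEvent)
    (a : NetAction) :
    configValue m β h (s.next E a) (blocksVoice E a) = contValue (β / m.totalRate s) h s E a := by
  simp only [configValue, contValue]
  split_ifs with hb
  · rw [next_of_blocksVoice hb]
  · rfl

theorem reward_add_generator_add_defect {β g : ℝ} {h : NetState → ℝ}
    (hg : ∀ s ∈ m.states,
      g = m.throughput s + (m.bellmanSum (β / m.totalRate s) h s - m.totalRate s * h s))
    (x : m.Config) :
    m.netReward β x.1.1 x.2 + (M.generator *ᵥ fun y => configValue m β h y.1.1 y.2) x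
      + M.defect β h x.1.1 = g := by
  rw [M.generator_mulVec, hg x.1.1 x.1.2]
  have hv := m.totalRate_pos x.1.1
  simp only [configValue_next]
  simp only [defect, mul_sub, Finset.sum_sub_distrib, bellmanSum, Finset.mul_sum, mul_assoc,
    configValue, netReward]
  -- With the flag set, the running cost `-β` cancels against `v * (β / v)`, the rate at which the
  -- correction in `configValue` is released.
  split_ifs
  · field_simp; ring
  · ring

/-- The expected reward, corrected by the accumulated defect, has average `g`. -/
theorem tendsto_expectedReward_add {β g : ℝ} {h : NetState → ℝ}
    (hg : ∀ s ∈ m.states,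
      g = m.throughput s + (m.bellmanSum (β / m.totalRate s) h s - m.totalRate s * h s))
    (s : {s : NetState // s ∈ m.states}) :
    Filter.Tendsto (fun t : ℝ => (M.expectedReward β s t + ∫ u in (0 : ℝ)..t,
        (M.transition u *ᵥ fun y => M.defect β h y.1.1) (s, false)) / t)
      Filter.atTop (nhds g) := by
  set hc : m.Config → ℝ := fun y => configValue m β h y.1.1 y.2
  obtain ⟨B, hB⟩ : ∃ B : ℝ, ∀ y, |hc y| ≤ B :=
    ⟨∑ y, |hc y|, fun y => Finset.single_le_sum (f := fun y => |hc y|)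
      (fun _ _ => abs_nonneg _) (Finset.mem_univ y)⟩
  have hlim : Filter.Tendsto (fun t : ℝ => 2 * B / t) Filter.atTop (nhds 0) :=
    tendsto_const_nhds.div_atTop Filter.tendsto_id
  rw [tendsto_iff_dist_tendsto_zero]
  refine squeeze_zero' (Filter.Eventually.of_forall fun _ => dist_nonneg) ?_ hlim
  filter_upwards [Filter.eventually_gt_atTop 0] with t ht
  have key := M.isGenerator.integral_reward (r := fun y => m.netReward β y.1.1 y.2)
    (d := fun y => M.defect β h y.1.1) (M.reward_add_generator_add_defect hg) (s, false) t
  have hE : M.expectedReward β s t = ∫ u in (0 : ℝ)..t,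
      (NormedSpace.exp (u • M.generator) *ᵥ fun y => m.netReward β y.1.1 y.2) (s, false) := rfl
  have h1 := M.isGenerator.abs_exp_mulVec_le ht.le hB (s, false)
  have h2 := hB (s, false)
  rw [hE, key, Real.dist_eq]
  simp only [transition, sub_add_cancel]
  rw [sub_div, mul_div_assoc, div_self ht.ne', mul_one, sub_sub_cancel_left, abs_neg, abs_div,
    abs_of_pos ht]
  refine div_le_div_of_nonneg_right ?_ ht.le
  refine (abs_sub _ _).trans ?_
  change _ + |hc (s, false)| ≤ _
  linarith

theorem integral_defect_nonneg {d : m.Config → ℝ} (hd : ∀ y, 0 ≤ d y) (x : m.Config) {s t : ℝ}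
    (hs : 0 ≤ s) (hst : s ≤ t) : 0 ≤ ∫ u in s..t, (M.transition u *ᵥ d) x := by
  refine intervalIntegral.integral_nonneg hst fun u hu => ?_
  exact Finset.sum_nonneg fun y _ =>
    mul_nonneg (M.isGenerator.exp_nonneg (hs.trans hu.1) _ _) (hd y)

theorem eventually_le_gain {β g : ℝ} {h : NetState → ℝ}
    (hg : ∀ s ∈ m.states,
      g = m.throughput s + (m.bellmanSum (β / m.totalRate s) h s - m.totalRate s * h s))
    (s : {s : NetState // s ∈ m.states}) {ε : ℝ} (hε : 0 < ε) :
    ∀ᶠ t : ℝ in Filter.atTop, M.expectedReward β s t / t ≤ g + ε := by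
  have h1 := (M.tendsto_expectedReward_add hg s).eventually_lt_const (lt_add_of_pos_right g hε)
  filter_upwards [h1, Filter.eventually_gt_atTop 0] with t ht ht0
  refine le_trans ?_ ht.le
  refine div_le_div_of_nonneg_right ?_ ht0.le
  exact le_add_of_nonneg_right
    (M.integral_defect_nonneg (fun y => M.defect_nonneg β h y.1.2) _ le_rfl ht0.le)

theorem tendsto_gain {β g : ℝ} {h : NetState → ℝ}
    (hg : ∀ s ∈ m.states,
      g = m.throughput s + (m.bellmanSum (β / m.totalRate s) h s - m.totalRate s * h s))
    (hd : ∀ s ∈ m.states, M.defect β h s = 0) (s : {s : NetState // s ∈ m.states}) :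
    Filter.Tendsto (fun t : ℝ => M.expectedReward β s t / t) Filter.atTop (nhds g) := by
  have h1 := M.tendsto_expectedReward_add hg s
  have h0 : (fun y : m.Config => M.defect β h y.1.1) = 0 := funext fun y => hd _ y.1.2
  simpa only [h0, mulVec_zero, Pi.zero_apply, intervalIntegral.integral_zero, add_zero] using h1

theorem isOptimal_of_defect {β g : ℝ} {h : NetState → ℝ}
    (hg : ∀ s ∈ m.states,
      g = m.throughput s + (m.bellmanSum (β / m.totalRate s) h s - m.totalRate s * h s))
    (hd : ∀ s ∈ m.states, M.defect β h s = 0) : M.IsOptimal β :=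
  fun s => ⟨g, M.tendsto_gain hg hd s, fun M' _ hε => M'.eventually_le_gain hg s hε⟩

/-- A policy with average `g` from the empty state loses nothing in the states that occur. -/
theorem defect_eq_zero_of_reachable {β g : ℝ} {h : NetState → ℝ}
    (hg : ∀ s ∈ m.states,
      g = m.throughput s + (m.bellmanSum (β / m.totalRate s) h s - m.totalRate s * h s))
    (hM : Filter.Tendsto (fun t : ℝ => M.expectedReward β ⟨⟨0, 0, 0⟩, empty_mem_states⟩ t / t)
      Filter.atTop (nhds g)) {s : NetState} (hs : M.Reachable s) : M.defect β h s = 0 := by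
  obtain ⟨hsm, b, hp⟩ := hs.exists_path
  obtain ⟨η, hη, hexp⟩ := M.isGenerator.exists_le_exp hp
  set x : m.Config := (⟨⟨0, 0, 0⟩, empty_mem_states⟩, false)
  set d : m.Config → ℝ := fun y => M.defect β h y.1.1
  have hd0 : ∀ y, 0 ≤ d y := fun y => M.defect_nonneg β h y.1.2
  have hlim := (M.tendsto_expectedReward_add hg ⟨⟨0, 0, 0⟩, empty_mem_states⟩).sub hM
  rw [sub_self] at hlim
  have hge : ∀ᶠ t : ℝ in Filter.atTop, η * M.defect β h s / 2 ≤
      (M.expectedReward β ⟨⟨0, 0, 0⟩, empty_mem_states⟩ t + ∫ u in (0 : ℝ)..t,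
        (M.transition u *ᵥ d) x) / t - M.expectedReward β ⟨⟨0, 0, 0⟩, empty_mem_states⟩ t / t := by
    -- The lower bound `η` holds from time `1` on, and `t - 1 ≥ t / 2` for `t ≥ 2`.
    filter_upwards [Filter.eventually_ge_atTop 2] with t ht
    rw [← sub_div, add_sub_cancel_left]
    have hint : ∀ p q : ℝ, IntervalIntegrable (fun u => (M.transition u *ᵥ d) x)
        MeasureTheory.volume p q :=
      (continuous_exp_smul_mulVec M.generator d x).intervalIntegrable
    rw [← intervalIntegral.integral_add_adjacent_intervals (hint 0 1) (hint 1 t)]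
    have h1 := M.integral_defect_nonneg hd0 x (le_refl (0 : ℝ)) zero_le_one
    have h2 : ∫ _ in (1 : ℝ)..t, η * M.defect β h s ≤ ∫ u in (1 : ℝ)..t, (M.transition u *ᵥ d) x := by
      refine intervalIntegral.integral_mono_on (by linarith) intervalIntegrable_const (hint 1 t)
        fun u hu => ?_
      refine le_trans (mul_le_mul_of_nonneg_right (hexp u hu.1 x) (hd0 (⟨s, hsm⟩, b))) ?_
      exact Finset.single_le_sum (f := fun y => M.transition u x y * d y)
        (fun y _ => mul_nonneg (M.isGenerator.exp_nonneg (zero_le_one.trans hu.1) _ _) (hd0 y))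
        (Finset.mem_univ _)
    rw [intervalIntegral.integral_const, smul_eq_mul] at h2
    rw [le_div_iff₀ (by linarith)]
    have h3 := mul_nonneg hη.le (M.defect_nonneg β h hsm)
    nlinarith
  have hle := ge_of_tendsto hlim hge
  have h0 := M.defect_nonneg β h hsm
  nlinarith

end Policy

end NetModel

namespace NetModel

variable {m : NetModel}

/-! ### States with as many WiFi users as the threshold allows -/

/-- The number of WiFi users is as close to `kth` as the number of data users and the capacity of
LTE permit. -/
def Aligned (m : NetModel) (kth : ℕ) (s : NetState) : Prop :=
  (s.k < kth → s.j = 0) ∧ (kth < s.k → s.i + s.j = m.C)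

/-- If an action leads from an aligned state to one that is not aligned, some other feasible action
brings the number of WiFi users closer to `kth`. -/
theorem exists_toward_of_not_aligned {kth : ℕ} (hkth : kth ≤ m.W) {s : NetState}
    (hal : m.Aligned kth s) {E : NetEvent} {a : NetAction} (ha : m.Feasible s E a)
    (hn : ¬ m.Aligned kth (s.next E a)) :
    ∃ a', m.Feasible s E a' ∧ blocksVoice E a = false ∧ blocksVoice E a' = false ∧
      TowardThreshold kth (s.next E a) (s.next E a') := by
  obtain ⟨i, j, k⟩ := s
  obtain ⟨hs, ha⟩ := ha
  have hs' := (m.mem_states _).1 hs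
  cases E <;> cases a <;> simp only [ne_eq, not_or] at ha <;>
    simp only [Aligned, NetState.next] at hal hn hs'
  · exact absurd hal hn
  · omega
  · refine ⟨.A2, ⟨hs, ?_⟩, rfl, rfl, rfl, ?_⟩ <;> simp only [NetState.next, true_and] <;> omega
  · exact absurd hal hn
  · refine ⟨.A3, ⟨hs, ?_⟩, rfl, rfl, rfl, ?_⟩ <;> simp only [NetState.next, and_true] <;> omega
  · refine ⟨.A2, ⟨hs, ?_⟩, rfl, rfl, rfl, ?_⟩ <;> simp only [NetState.next, and_true] <;> omega
  · refine ⟨.A5, ⟨hs, ?_⟩, rfl, rfl, rfl, ?_⟩ <;> simp only [NetState.next, and_true] <;> omega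
  · refine ⟨.A1, ⟨hs, ?_⟩, rfl, rfl, rfl, ?_⟩ <;> simp only [NetState.next, and_true] <;> omega
  · refine ⟨.A5, ⟨hs, ?_⟩, rfl, rfl, rfl, ?_⟩ <;> simp only [NetState.next] <;> omega
  · refine ⟨.A1, ⟨hs, ?_⟩, rfl, rfl, rfl, ?_⟩ <;> simp only [NetState.next] <;> omega
  · refine ⟨.A5, ⟨hs, ?_⟩, rfl, rfl, rfl, ?_⟩ <;> simp only [NetState.next] <;> omega
  · refine ⟨.A1, ⟨hs, ?_⟩, rfl, rfl, rfl, ?_⟩ <;> simp only [NetState.next] <;> omega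

namespace Policy

variable {M : m.Policy} {kth : ℕ}

/-- A policy whose reachable transitions preserve alignment has the threshold structure. -/
theorem servesThreshold_of_aligned
    (h : ∀ s, M.Reachable s → s ∈ m.states → m.Aligned kth s → ∀ E a, 0 < m.rate s E →
      0 < M.prob s E a → m.Aligned kth (s.next E a)) : M.ServesThreshold kth := by
  have hreach : ∀ s, M.Reachable s → s ∈ m.states ∧ m.Aligned kth s := by
    intro s hs
    induction hs with
    | empty => exact ⟨empty_mem_states, by simp [Aligned]⟩
    | step s E a hr hE ha ih =>
      exact ⟨(M.feasible_of_pos ha).next_mem, h s hr ih.1 ih.2 E a hE ha⟩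
  intro s hr hC
  obtain ⟨hs, hal⟩ := hreach s hr
  have hnext := h s hr hs hal
  obtain ⟨h1, h2, h3⟩ := m.rate_departure_pos (s := s)
  obtain ⟨i, j, k⟩ := s
  simp only [Aligned] at hal hnext hC h1 h2 h3 ⊢
  -- With `i + j < C`, alignment and at least `kth` data users force `k = kth`. In each case below,
  -- any feasible action other than the prescribed one would leave the aligned set.
  refine ⟨fun hn => ⟨by omega, ?_⟩, fun hn => ⟨fun hi => ?_, fun hj => ?_, fun hk => ?_⟩⟩
  · refine M.prob_eq_one (E := .dataArrival) hs m.lamD_pos fun a ha hpos => ?_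
    have hf := (M.feasible_of_pos hpos).2
    have hn' := hnext .dataArrival a m.lamD_pos hpos
    clear hnext
    cases a <;> first
      | exact absurd rfl ha
      | exact hf.elim
      | simp only [NetState.next, ne_eq] at hf hn'; omega
  · refine M.prob_eq_one hs (h1.2 hi) fun a ha hpos => ?_
    have hf := (M.feasible_of_pos hpos).2
    have hn' := hnext .voiceDepartureLTE a (h1.2 hi) hpos
    clear hnext
    cases a <;> first
      | exact absurd rfl ha
      | exact hf.elim
      | simp only [NetState.next, not_or] at hf hn'; omega
  · refine M.prob_eq_one hs (h2.2 hj) fun a ha hpos => ?_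
    have hf := (M.feasible_of_pos hpos).2
    have hn' := hnext .dataDepartureLTE a (h2.2 hj) hpos
    clear hnext
    cases a <;> first
      | exact absurd rfl ha
      | exact hf.elim
      | simp only [NetState.next, not_or] at hf hn'; omega
  · refine M.prob_eq_one hs (h3.2 hk) fun a ha hpos => ?_
    have hf := (M.feasible_of_pos hpos).2
    have hn' := hnext .dataDepartureWiFi a (h3.2 hk) hpos
    clear hnext
    cases a <;> first
      | exact absurd rfl ha
      | exact hf.elim
      | simp only [NetState.next, ne_eq] at hf hn'; omega

end Policy

/-- Without ties, a solution of the optimality equation strictly prefers WiFi loads closer to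
`kth`. -/
theorem lt_of_toward {kth : ℕ} (hkth : m.IsThreshold kth)
    (hstrict : ∀ k, kth ≤ k → k < m.W → m.wifiIncrement k < m.RLD) {β g : ℝ} {h : NetState → ℝ}
    (huni : m.WifiUnimodal kth h)
    (hg : ∀ s ∈ m.states,
      g = m.throughput s + (m.bellmanSum (β / m.totalRate s) h s - m.totalRate s * h s))
    {s s' : NetState} (hs : s ∈ m.states) (hs' : s' ∈ m.states) (ht : TowardThreshold kth s s') :
    h s < h s' := by
  have e1 := hg s hs
  have e2 := hg s' hs'
  have hpos := m.totalRate_pos s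
  have hv : m.totalRate s = m.totalRate s' := by
    obtain ⟨i, j, k⟩ := s
    obtain ⟨i', j', k'⟩ := s'
    simp only [TowardThreshold] at ht
    obtain ⟨rfl, ⟨hk, rfl, rfl⟩ | ⟨hk, rfl, rfl⟩⟩ := ht
    · rw [totalRate_shift]
    · rw [totalRate_shift]
  have hb : m.bellmanSum (β / m.totalRate s) h s ≤ m.bellmanSum (β / m.totalRate s') h s' :=
    (huni.bellmanSum (c := fun s => β / m.totalRate s)
      fun i j k => by rw [totalRate_shift]).le_of_toward hs hs' ht
  have hf : m.throughput s < m.throughput s' := by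
    rw [mem_states] at hs hs'
    obtain ⟨i, j, k⟩ := s
    obtain ⟨i', j', k'⟩ := s'
    simp only [TowardThreshold] at ht hs hs'
    obtain ⟨rfl, ⟨hk, rfl, rfl⟩ | ⟨hk, rfl, rfl⟩⟩ := ht
    · have := throughput_shift (m := m) i j' k
      linarith [hkth.2.2 k hk]
    · have := throughput_shift (m := m) i j k'
      linarith [hstrict k' (by omega) (by omega)]
  -- The equation reads `v * h = f + bellmanSum - g` with the same `v` at both states: the
  -- throughput increases strictly and the Bellman sum weakly.
  rw [← hv] at e2 hb
  have : m.totalRate s * h s < m.totalRate s * h s' := by linarith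
  exact lt_of_mul_lt_mul_left this hpos.le

/-- Distance of the number of WiFi users from `kth`. -/
def wifiDist (kth : ℕ) (s : NetState) : ℕ := (s.k - kth) + (kth - s.k)

theorem TowardThreshold.wifiDist_lt {kth : ℕ} {s s' : NetState} (h : TowardThreshold kth s s') :
    wifiDist kth s' < wifiDist kth s := by
  simp only [TowardThreshold, wifiDist] at *; omega

/-- Among the best actions there is one that follows the threshold rule and preserves alignment. -/
theorem exists_best_aligned {kth : ℕ} (hkth : kth ≤ m.W) {J : NetState → ℝ}
    (hJ : m.WifiUnimodal kth J) (c : ℝ) {s : NetState} (hs : s ∈ m.states) {E : NetEvent}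
    (hE : 0 < m.rate s E) :
    ∃ a, m.Feasible s E a ∧ contValue c J s E a = m.bestValue c J s E ∧
      (s.i + s.j < m.C → ∀ a', ThresholdRule kth s E a' → a' = a) ∧
      (m.Aligned kth s → m.Aligned kth (s.next E a)) := by
  obtain ⟨b, hb, hbest⟩ := exists_bestValue hs hE c J
  -- Ties are broken by taking a best action that ends closest to `kth`. A feasible non-blocking
  -- alternative one step closer would be best too, by unimodality, and contradict minimality.
  obtain ⟨a, ⟨ha, habest⟩, hmin⟩ := Set.exists_min_image
    {a | m.Feasible s E a ∧ contValue c J s E a = m.bestValue c J s E}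
    (fun a => wifiDist kth (s.next E a)) (Set.toFinite _) ⟨b, hb, hbest.symm⟩
  have hnot : ∀ a', m.Feasible s E a' → blocksVoice E a = false → blocksVoice E a' = false →
      ¬ TowardThreshold kth (s.next E a) (s.next E a') := by
    intro a' ha' h1 h2 ht
    have hle : contValue c J s E a ≤ contValue c J s E a' := by
      simpa [contValue, h1, h2] using hJ.le_of_toward ha.next_mem ha'.next_mem ht
    have := hmin a' ⟨ha', le_antisymm (contValue_le_bestValue ha') (habest ▸ hle)⟩
    exact absurd ht.wifiDist_lt (not_lt.2 this)
  refine ⟨a, ha, habest, fun hC a' hr => ?_, fun hal => ?_⟩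
  · obtain ⟨hf, ht⟩ := hr.toward hkth hs hC hE
    refine ((ht a ha).resolve_right ?_).symm
    exact hnot a' hf (hr.blocksVoice_eq_false a) (hr.blocksVoice_eq_false a')
  · by_contra hn
    obtain ⟨a', ha', h1, h2, ht⟩ := exists_toward_of_not_aligned hkth hal ha hn
    exact hnot a' ha' h1 h2 ht

open Classical in
/-- The pure policy given by a choice of feasible actions. -/
noncomputable def purePolicy (m : NetModel) (σ : NetState → NetEvent → NetAction)
    (hσ : ∀ s ∈ m.states, m.IsSelection s (σ s)) : m.Policy where
  prob s E a := if s ∈ m.states ∧ 0 < m.rate s E ∧ a = σ s E then 1 else 0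
  nonneg s E a := by split_ifs <;> norm_num
  feasible s E a h := by
    simp only [ne_eq, ite_eq_right_iff, one_ne_zero, imp_false, not_not] at h
    exact h.2.2 ▸ hσ s h.1 E h.2.1
  sum_one s hs E hE := by simp [hs, hE]

section purePolicy

variable {σ : NetState → NetEvent → NetAction} {hσ : ∀ s ∈ m.states, m.IsSelection s (σ s)}

theorem purePolicy_isPure : (m.purePolicy σ hσ).IsPure := by
  intro s E a
  simp only [purePolicy]
  split_ifs <;> simp

theorem purePolicy_prob_eq_one {s : NetState} (hs : s ∈ m.states) {E : NetEvent}
    (hE : 0 < m.rate s E) : (m.purePolicy σ hσ).prob s E (σ s E) = 1 := by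
  simp [purePolicy, hs, hE]

theorem eq_of_purePolicy_prob_pos {s : NetState} {E : NetEvent} {a : NetAction}
    (h : 0 < (m.purePolicy σ hσ).prob s E a) : a = σ s E := by
  by_contra hne
  simp [purePolicy, hne] at h

theorem purePolicy_defect {β : ℝ} {h : NetState → ℝ} {s : NetState} (hs : s ∈ m.states)
    (hbest : ∀ E, 0 < m.rate s E → contValue (β / m.totalRate s) h s E (σ s E) =
      m.bestValue (β / m.totalRate s) h s E) : (m.purePolicy σ hσ).defect β h s = 0 := by
  refine Finset.sum_eq_zero fun E _ => ?_
  rcases (m.rate_nonneg s E).eq_or_lt with h0 | h0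
  · simp [← h0]
  · simp [purePolicy, hs, h0, hbest E h0]

end purePolicy

end NetModel

/-! ### The three claims -/

theorem lemma2 (m : NetModel) (kth : ℕ) (hkth : m.IsThreshold kth) (β : ℝ) :
    -- a pure optimal policy with the threshold structure exists
    (∃ M : m.Policy, M.IsPure ∧ M.IsOptimal β ∧ M.ServesThreshold kth ∧
      ∀ s ∈ m.states, s.i + s.j < m.C → ∀ E a, 0 < m.rate s E →
        ThresholdRule kth s E a → M.prob s E a = 1) ∧
    -- without ties, every optimal memoryless policy has it
    ((∀ k, kth ≤ k → k < m.W → m.wifiIncrement k < m.RLD) →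
      ∀ M : m.Policy, M.IsOptimal β → M.ServesThreshold kth) ∧
    -- the prescribed actions attain the maximum at every stage of value iteration
    (∀ δ : ℝ, 0 < δ → (∀ s ∈ m.states, δ * m.totalRate s ≤ 1) →
      ∀ (n : ℕ), ∀ s ∈ m.states, s.i + s.j < m.C → ∀ E a, 0 < m.rate s E →
        ThresholdRule kth s E a → m.IsOptimalAction β (m.valueIter β δ n) s E a) := by
  obtain ⟨g, h, huni, hg⟩ := NetModel.exists_averageOptimality hkth β
  have hex : ∀ s E, ∃ a, s ∈ m.states → 0 < m.rate s E → m.Feasible s E a ∧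
      NetModel.contValue (β / m.totalRate s) h s E a = m.bestValue (β / m.totalRate s) h s E ∧
      (s.i + s.j < m.C → ∀ a', ThresholdRule kth s E a' → a' = a) ∧
      (m.Aligned kth s → m.Aligned kth (s.next E a)) := by
    intro s E
    by_cases hsE : s ∈ m.states ∧ 0 < m.rate s E
    · obtain ⟨a, ha⟩ := NetModel.exists_best_aligned hkth.1 huni (β / m.totalRate s) hsE.1 hsE.2
      exact ⟨a, fun _ _ => ha⟩
    · exact ⟨.A1, fun h1 h2 => absurd ⟨h1, h2⟩ hsE⟩
  choose σ hσ using hex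
  have hsel : ∀ s ∈ m.states, m.IsSelection s (σ s) := fun s hs E hE => (hσ s E hs hE).1
  have hdef : ∀ s ∈ m.states, (m.purePolicy σ hsel).defect β h s = 0 := fun s hs =>
    NetModel.purePolicy_defect hs fun E hE => (hσ s E hs hE).2.1
  refine ⟨⟨m.purePolicy σ hsel, NetModel.purePolicy_isPure,
    NetModel.Policy.isOptimal_of_defect _ hg hdef, ?_, ?_⟩, ?_, ?_⟩
  · refine NetModel.Policy.servesThreshold_of_aligned fun s _ hs hal E a hE ha => ?_
    rw [NetModel.eq_of_purePolicy_prob_pos ha]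
    exact (hσ s E hs hE).2.2.2 hal
  · intro s hs hC E a hE hr
    rw [(hσ s E hs hE).2.2.1 hC a hr]
    exact NetModel.purePolicy_prob_eq_one hs hE
  · intro hstrict M hM
    obtain ⟨v, hv, hmax⟩ := hM ⟨⟨0, 0, 0⟩, NetModel.empty_mem_states⟩
    have hstar := (m.purePolicy σ hsel).tendsto_gain hg hdef ⟨⟨0, 0, 0⟩, NetModel.empty_mem_states⟩
    -- The verification bound for `M` gives `v ≤ g`; optimality of `M` against the greedy policy,
    -- whose average is `g`, gives the converse.
    have hvg : v = g := le_antisymm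
      (le_of_forall_pos_le_add fun ε hε => le_of_tendsto hv (M.eventually_le_gain hg _ hε))
      (le_of_forall_pos_le_add fun ε hε => le_of_tendsto hstar (hmax _ ε hε))
    rw [hvg] at hv
    refine NetModel.Policy.servesThreshold_of_aligned fun s hr hs hal E a hE ha => ?_
    by_contra hn
    have hf := M.feasible_of_pos ha
    have hbest := M.contValue_eq_of_defect_eq_zero hs (M.defect_eq_zero_of_reachable hg hv hr) hE ha
    obtain ⟨a', ha', h1, h2, ht⟩ := NetModel.exists_toward_of_not_aligned hkth.1 hal hf hn
    have hle := NetModel.contValue_le_bestValue (c := β / m.totalRate s) (J := h) ha'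
    rw [← hbest] at hle
    simp only [NetModel.contValue, h1, h2, Bool.false_eq_true, if_false, sub_zero] at hle
    exact absurd (NetModel.lt_of_toward hkth hstrict huni hg hf.next_mem ha'.next_mem ht)
      (not_lt.2 hle)
  · intro δ hδ hδv n s hs hC E a hE hr
    exact NetModel.isOptimalAction_of_rule hkth β hδ hδv n hs hC hE hr
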